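/- Let $M$ be a compact smooth manifold with corners and let $I=[0,1]$. For smooth $g:M\to U(n)$ let $$Ch(g)=\mathrm{Tr}\sum_{j\ge 0}\frac{(-1)^j}{(2\pi i)^{j+1}}\frac{j!}{(2j+1)!}\,(g^{-1}dg)^{2j+1}\in\Omega^{\mathrm{odd}}(M;\mathbb R),$$ and for a smooth path $g_t$, i.e. a smooth map $M\times I\to U(n)$, let $$CS(g_t)=\int_I Ch(g_t)\in\Omega^{\mathrm{even}}(M;\mathbb R)$$ be the integral along the fibre of $M\times I\to M$ of the form $Ch(g_t)$ on $M\times I$ (contracted with $\partial/\partial t$ in the first slot). Let $Map(M,U)=\varinjlim_n Map(M,U(n))$ be the set of smooth maps from $M$ to the stable unitary group $U=\varinjlim_n U(n)$, the limits being taken along $A\mapsto \mathrm{diag}(A,1)$. For $g_0,g_1\in Map(M,U)$ write $g_0\sim g_1$ if for some $n$ there is a smooth path $g_t:M\times I\to U(n)$ whose endpoints represent $g_0$ and $g_1$ and such that $CS(g_t)$ is $d$-exact, i.e. equal to $d\eta$ for some smooth $\eta\in\Omega^{\mathrm{odd}}(M;\mathbb R)$. Then $\sim$ is an equivalence relation.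 Let $\hat K^{-1}(M)=Map(M,U)/{\sim}$, and write $[g]$ for the class of $g:M\to U(n)$. The block sum $(g,h)\mapsto g\oplus h=\mathrm{diag}(g,h)$ induces a well-defined abelian group structure on $\hat K^{-1}(M)$: there is exactly one abelian group structure on $\hat K^{-1}(M)$ such that, for all $m,n$ and all smooth $g:M\to U(m)$ and $h:M\to U(n)$, $$[g]+[h]=[g\oplus h],\qquad [1]=0,\qquad -[g]=[g^{-1}],$$ where $1$ is the constant map to an identity matrix (of any size) and $g^{-1}$ is the pointwise inverse. Moreover, for all such $g,h$ there is a smooth path in $Map(M,U)$ (that is, a smooth map $M\times I\to U(k)$ for some $k$) from $g\oplus h$ to $h\oplus g$ with $CS=0$, and a smooth path from $g\oplus g^{-1}$ to the constant map $1$ with $CS=0$. -/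

import Mathlib

open scoped Manifold ContDiff

noncomputable section

namespace OddDiffK

/-! ### Real differential forms on a manifold with corners -/

section Forms

variable {E : Type*} [NormedAddCommGroup E] [NormedSpace ℝ E]
  {H : Type*} [TopologicalSpace H] (I : ModelWithCorners ℝ E H)
  (M : Type*) [TopologicalSpace M] [ChartedSpace H M]

/-- A (not necessarily smooth) real differential `k`-form on `M`. -/
abbrev Form (k : ℕ) : Type _ := ∀ x : M, (TangentSpace I x) [⋀^Fin k]→L[ℝ] ℝ

variable {I M}

/-- The expression of a `k`-form in the chart around `x₀`: its pullback along the inverse of the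
chart, a form on (the relevant subset of) the model space `E`. -/
def Form.inChart {k : ℕ} (α : Form I M k) (x₀ : M) : E → E [⋀^Fin k]→L[ℝ] ℝ := fun y =>
  (α ((extChartAt I x₀).symm y)).compContinuousLinearMap
    (mfderivWithin 𝓘(ℝ, E) I (extChartAt I x₀).symm (Set.range I) y)

/-- A form is smooth if it is smooth in charts (up to the boundary). -/
def Form.IsSmooth {k : ℕ} (α : Form I M k) : Prop :=
  ∀ x₀ : M, ContDiffOn ℝ ∞ (α.inChart x₀) (extChartAt I x₀).target

/-- The exterior derivative of a form, computed at `x` in the chart around `x`. -/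
def Form.d {k : ℕ} (α : Form I M k) : Form I M (k + 1) := fun x =>
  (extDerivWithin (α.inChart x) (Set.range I) (extChartAt I x x)).compContinuousLinearMap
    (mfderiv I 𝓘(ℝ, E) (extChartAt I x) x)

variable (I M) in
/-- The values of a family of forms of all even degrees; the degree `2 * n` component
sends `x` and `2 * n` tangent vectors at `x` to a complex number. -/
abbrev EvenFamily : Type _ := ∀ (n : ℕ) (x : M), (Fin (2 * n) → TangentSpace I x) → ℂ

/-- The even family `c` is a real `d`-exact form: `c = dη` for a smooth real odd form `η`.
Sorted by degrees, the degree `0` component vanishes, and for all `n` the component of degree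
`2 * n + 2` is `dη` for a smooth real form `η` of degree `2 * n + 1`. -/
def EvenFamily.IsExact (c : EvenFamily I M) : Prop :=
  c 0 = 0 ∧ ∀ n : ℕ, ∃ η : Form I M (2 * n + 1), η.IsSmooth ∧
    ∀ (x : M) (v : Fin (2 * (n + 1)) → TangentSpace I x), c (n + 1) x v = ((η.d x v : ℝ) : ℂ)

end Forms

/-! ### The odd Chern form of a map into a unitary group -/

section Chern

variable {F : Type*} [NormedAddCommGroup F] [NormedSpace ℝ F]
  {K : Type*} [TopologicalSpace K] (J : ModelWithCorners ℝ F K)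
  {N : Type*} [TopologicalSpace N] [ChartedSpace K N]
  {ι : Type*} [Fintype ι] [DecidableEq ι]

/-- The differential of the matrix entry `g i j` at the point `p`, for a map `g` that is smooth on
the domain `s` (a set with unique derivatives) in a manifold `N`. -/
def entryDiff (s : Set N) (g : N → Matrix.unitaryGroup ι ℂ) (p : N) (i j : ι) :
    TangentSpace J p →L[ℝ] ℂ :=
  mfderivWithin J 𝓘(ℝ, ℂ) (fun q => (g q).1 i j) s p

/-- The matrix valued `1`-form `g⁻¹ dg` at the point `p`. -/
def maurerCartan (s : Set N) (g : N → Matrix.unitaryGroup ι ℂ) (p : N) :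
    TangentSpace J p →ₗ[ℝ] Matrix ι ι ℂ where
  toFun w := ((g p)⁻¹ : Matrix.unitaryGroup ι ℂ).1 *
    Matrix.of fun i j => entryDiff J s g p i j w
  map_add' v w := by
    rw [← mul_add]
    congr 1
    ext i j
    exact map_add (entryDiff J s g p i j) v w
  map_smul' a v := by
    rw [RingHom.id_apply, ← mul_smul_comm]
    congr 1
    ext i j
    exact map_smul (entryDiff J s g p i j) a v

/-- The `k`-th exterior power `A ∧ ⋯ ∧ A` of a matrix valued `1`-form `A` at a point,
`(v₁, …, v_k) ↦ ∑ σ, sign σ • A v_{σ 1} * ⋯ * A v_{σ k}`. -/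
def wedgePow {V : Type*} [AddCommGroup V] [Module ℝ V] (A : V →ₗ[ℝ] Matrix ι ι ℂ) (k : ℕ) :
    V [⋀^Fin k]→ₗ[ℝ] Matrix ι ι ℂ :=
  MultilinearMap.alternatization
    ((MultilinearMap.mkPiAlgebraFin ℝ k (Matrix ι ι ℂ)).compLinearMap fun _ => A)

/-- The component of degree `2 * n + 1` of the odd Chern form
`Ch(g) = Tr ∑ₙ (-1)ⁿ / (2πi)ⁿ⁺¹ * n! / (2n+1)! * (g⁻¹ dg)²ⁿ⁺¹`. -/
def oddChern (s : Set N) (g : N → Matrix.unitaryGroup ι ℂ) (n : ℕ) (p : N) :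
    (TangentSpace J p) [⋀^Fin (2 * n + 1)]→ₗ[ℝ] ℂ :=
  ((-1 : ℂ) ^ n / (2 * Real.pi * Complex.I) ^ (n + 1) *
      (n.factorial / (2 * n + 1).factorial : ℂ)) •
    (Matrix.traceLinearMap ι ℝ ℂ).compAlternatingMap
      (wedgePow (maurerCartan J s g p) (2 * n + 1))

end Chern

/-! ### Maps into unitary groups, block sum, and maps into the stable unitary group -/

section Maps

variable {E : Type*} [NormedAddCommGroup E] [NormedSpace ℝ E]
  {H : Type*} [TopologicalSpace H] (I : ModelWithCorners ℝ E H)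
  (M : Type*) [TopologicalSpace M] [ChartedSpace H M]

/-- `Map(M, U(n))`: smooth maps from `M` to the unitary group `U(n)`
(smoothness is smoothness of the matrix entries, `U(n)` being embedded in the matrices). -/
structure UMap (n : ℕ) where
  toFun : M → Matrix.unitaryGroup (Fin n) ℂ
  smooth : ∀ i j : Fin n, ContMDiff I 𝓘(ℝ, ℂ) ∞ fun x => (toFun x).1 i j

/-- `M × [0,1]`, as a subset of the manifold `M × ℝ`. -/
def cylinder : Set (M × ℝ) := Set.univ ×ˢ Set.Icc (0 : ℝ) 1

/-- A smooth map `g_t : M × [0,1] → U(n)`; the values outside `M × [0,1]` play no role. -/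
structure UPath (n : ℕ) where
  toFun : M × ℝ → Matrix.unitaryGroup (Fin n) ℂ
  smooth : ∀ i j : Fin n,
    ContMDiffOn (I.prod 𝓘(ℝ, ℝ)) 𝓘(ℝ, ℂ) ∞ (fun p => (toFun p).1 i j) (cylinder M)

variable {I M}

/-- The map `g_t : M → U(n)` for a fixed time `t ∈ [0,1]`. -/
def UPath.atTime {n : ℕ} (γ : UPath I M n) (t : ℝ) (ht : t ∈ Set.Icc (0 : ℝ) 1) : UMap I M n where
  toFun x := γ.toFun (x, t)
  smooth i j :=
    (γ.smooth i j).comp_contMDiff (contMDiff_id.prodMk contMDiff_const)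
      fun x => ⟨Set.mem_univ x, ht⟩

/-- The start `g₀` of a path. -/
def UPath.start {n : ℕ} (γ : UPath I M n) : UMap I M n := γ.atTime 0 ⟨le_rfl, zero_le_one⟩

/-- The end `g₁` of a path. -/
def UPath.finish {n : ℕ} (γ : UPath I M n) : UMap I M n := γ.atTime 1 ⟨zero_le_one, le_rfl⟩

/-- The tangent vector `∂/∂t` of `M × ℝ` at `(x, t)`. -/
def timeVector (x : M) (t : ℝ) : TangentSpace (I.prod 𝓘(ℝ, ℝ)) (x, t) := ((0 : E), (1 : ℝ))

/-- A tangent vector of `M` at `x`, as a tangent vector of `M × ℝ` at `(x, t)`. -/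
def spaceVector (x : M) (t : ℝ) (v : TangentSpace I x) :
    TangentSpace (I.prod 𝓘(ℝ, ℝ)) (x, t) := ((v : E), (0 : ℝ))

/-- The Chern-Simons form `CS(g_t) = ∫_I Ch(g_t)` of a path: the integral along the fibre of
`M × [0,1] → M` of the odd Chern form of `g_t : M × [0,1] → U(n)`. Its component of degree
`2 * n` sends `v₁, …, v_{2n}` to `∫₀¹ Ch(g_t)_{(x,t)} (∂/∂t, v₁, …, v_{2n}) dt`. -/
def UPath.CS {k : ℕ} (γ : UPath I M k) : EvenFamily I M := fun n x v =>
  ∫ t in (0 : ℝ)..1,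
    oddChern (I.prod 𝓘(ℝ, ℝ)) (cylinder M) γ.toFun n (x, t)
      (Fin.cons (timeVector x t) fun i => spaceVector x t (v i))

/-- The block sum `diag(A, B)` of unitary matrices. -/
def blockSum {m n : ℕ} (A : Matrix.unitaryGroup (Fin m) ℂ) (B : Matrix.unitaryGroup (Fin n) ℂ) :
    Matrix.unitaryGroup (Fin (m + n)) ℂ :=
  ⟨Matrix.reindex finSumFinEquiv finSumFinEquiv (Matrix.fromBlocks A.1 0 0 B.1), by
    have hA := Matrix.mem_unitaryGroup_iff.1 A.2
    have hB := Matrix.mem_unitaryGroup_iff.1 B.2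
    rw [Matrix.star_eq_conjTranspose] at hA hB
    rw [Matrix.mem_unitaryGroup_iff, Matrix.star_eq_conjTranspose, Matrix.conjTranspose_reindex,
      Matrix.reindex_apply, Matrix.reindex_apply, Matrix.submatrix_mul_equiv,
      Matrix.fromBlocks_conjTranspose, Matrix.fromBlocks_multiply]
    simp [hA, hB]⟩

/-- The pointwise block sum `g ⊕ h`. -/
def UMap.blockSum {m n : ℕ} (g : UMap I M m) (h : UMap I M n) : UMap I M (m + n) where
  toFun x := OddDiffK.blockSum (g.toFun x) (h.toFun x)
  smooth i j := by
    rcases hi : finSumFinEquiv.symm i with a | a <;> rcases hj : finSumFinEquiv.symm j with b | b <;>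
      simp only [OddDiffK.blockSum, Matrix.reindex_apply, Matrix.submatrix_apply, hi, hj,
        Matrix.fromBlocks_apply₁₁, Matrix.fromBlocks_apply₁₂, Matrix.fromBlocks_apply₂₁,
        Matrix.fromBlocks_apply₂₂, Matrix.zero_apply]
    exacts [g.smooth a b, contMDiff_const, contMDiff_const, h.smooth a b]

/-- The pointwise inverse `g⁻¹`. -/
def UMap.inv {n : ℕ} (g : UMap I M n) : UMap I M n where
  toFun x := (g.toFun x)⁻¹
  smooth i j := by
    have h : ContMDiff 𝓘(ℝ, ℂ) 𝓘(ℝ, ℂ) ∞ (fun z : ℂ => star z) :=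
      (Complex.conjCLE.contDiff (n := ∞)).contMDiff
    exact h.comp (g.smooth j i)

variable (I M) in
/-- The constant map to the identity matrix of `U(n)`. -/
def UMap.one (n : ℕ) : UMap I M n where
  toFun _ := 1
  smooth _ _ := contMDiff_const

/-- The infinite matrix `diag(A, 1, 1, …)`: the image of `A ∈ U(n)` in the stable unitary group. -/
def stabilize {n : ℕ} (A : Matrix.unitaryGroup (Fin n) ℂ) : ℕ → ℕ → ℂ := fun i j =>
  if h : i < n ∧ j < n then A.1 ⟨i, h.1⟩ ⟨j, h.2⟩ else if i = j then 1 else 0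

variable (I M) in
/-- `Map(M, U) = lim Map(M, U(n))` for the stable unitary group `U = lim U(n)`, the limits being
along `A ↦ diag(A, 1)`: maps from `M` to infinite matrices that arise, for some `n`, from a
smooth map `M → U(n)`. -/
def StableMap : Type _ :=
  {f : M → ℕ → ℕ → ℂ // ∃ (n : ℕ) (g : UMap I M n), f = fun x => stabilize (g.toFun x)}

/-- The element of `Map(M, U)` represented by `g : M → U(n)`. -/
def UMap.toStable {n : ℕ} (g : UMap I M n) : StableMap I M :=
  ⟨fun x => stabilize (g.toFun x), n, g, rfl⟩

/-- The path `γ`, of maps to `U(n)` for some `n`, goes from `g₀` to `g₁` in `Map(M, U)`. -/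
def UPath.Joins {n : ℕ} (γ : UPath I M n) (g₀ g₁ : StableMap I M) : Prop :=
  γ.start.toStable = g₀ ∧ γ.finish.toStable = g₁

variable (I M) in
/-- Chern-Simons equivalence on `Map(M, U)`: `g₀ ∼ g₁` if there is a smooth path `g_t` from
`g₀` to `g₁` such that `CS(g_t)` is `d`-exact. -/
def CSEquiv (g₀ g₁ : StableMap I M) : Prop :=
  ∃ (n : ℕ) (γ : UPath I M n), γ.Joins g₀ g₁ ∧ γ.CS.IsExact

variable (I M) in
/-- `K̂⁻¹(M)`: the classes of `Map(M, U)` modulo Chern-Simons equivalence. -/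
def KHat : Type _ := Quot (CSEquiv I M)

/-- The class in `K̂⁻¹(M)` of a map `g : M → U(n)`. -/
def UMap.cls {n : ℕ} (g : UMap I M n) : KHat I M := Quot.mk (CSEquiv I M) g.toStable

end Maps

end OddDiffK

end

noncomputable section

namespace OddDiffK

section Algebra

open Matrix

variable {ι : Type*} [Fintype ι] [DecidableEq ι]

variable (ι) in
/-- The component of degree `2 * n + 1` of the odd Chern form, as an alternating form of the
values of `g⁻¹ dg`. -/
def chernForm (n : ℕ) : (Matrix ι ι ℂ) [⋀^Fin (2 * n + 1)]→ₗ[ℝ] ℂ :=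
  ((-1 : ℂ) ^ n / (2 * Real.pi * Complex.I) ^ (n + 1) *
      (n.factorial / (2 * n + 1).factorial : ℂ)) •
    (Matrix.traceLinearMap ι ℝ ℂ).compAlternatingMap (wedgePow LinearMap.id (2 * n + 1))

theorem wedgePow_apply {V : Type*} [AddCommGroup V] [Module ℝ V] (A : V →ₗ[ℝ] Matrix ι ι ℂ)
    (k : ℕ) (v : Fin k → V) :
    wedgePow A k v = ∑ σ : Equiv.Perm (Fin k),
      Equiv.Perm.sign σ • (List.ofFn fun i => A (v (σ i))).prod := by
  simp [wedgePow, MultilinearMap.alternatization_apply]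

theorem oddChern_apply {F : Type*} [NormedAddCommGroup F] [NormedSpace ℝ F]
    {K : Type*} [TopologicalSpace K] (J : ModelWithCorners ℝ F K)
    {N : Type*} [TopologicalSpace N] [ChartedSpace K N] (s : Set N)
    (g : N → Matrix.unitaryGroup ι ℂ) (n : ℕ) (p : N) (v : Fin (2 * n + 1) → TangentSpace J p) :
    oddChern J s g n p v = chernForm ι n fun i => maurerCartan J s g p (v i) := by
  simp only [oddChern, chernForm, AlternatingMap.smul_apply, LinearMap.compAlternatingMap_apply,
    wedgePow_apply, LinearMap.id_apply]

theorem chernForm_eq_sum (n : ℕ) (a : Fin (2 * n + 1) → Matrix ι ι ℂ) :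
    chernForm ι n a = ((-1 : ℂ) ^ n / (2 * Real.pi * Complex.I) ^ (n + 1) *
      (n.factorial / (2 * n + 1).factorial : ℂ)) * ∑ σ : Equiv.Perm (Fin (2 * n + 1)),
        Equiv.Perm.sign σ • (List.ofFn fun i => a (σ i)).prod.trace := by
  simp only [chernForm, AlternatingMap.smul_apply, LinearMap.compAlternatingMap_apply,
    wedgePow_apply, LinearMap.id_apply, smul_eq_mul, map_sum]
  congr 1
  refine Finset.sum_congr rfl fun σ _ => ?_
  rcases Int.units_eq_one_or (Equiv.Perm.sign σ) with h | h <;> simp [h]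

theorem chernForm_cons_smul (n : ℕ) (c : ℝ) (T : Matrix ι ι ℂ) (V : Fin (2 * n) → Matrix ι ι ℂ) :
    chernForm ι n (Fin.cons (c • T) V) = c • chernForm ι n (Fin.cons T V) :=
  (chernForm ι n).toMultilinearMap.cons_smul V c T

theorem chernForm_cons_zero (n : ℕ) (V : Fin (2 * n) → Matrix ι ι ℂ) :
    chernForm ι n (Fin.cons 0 V) = 0 :=
  (chernForm ι n).map_coord_zero (i := 0) rfl

theorem chernForm_cons_eq_zero (n : ℕ) (T : Matrix ι ι ℂ) (V : Fin (2 * n) → Matrix ι ι ℂ)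
    (h : ∀ l : List (Matrix ι ι ℂ), l.length = 2 * n → (∀ B ∈ l, ∃ i, B = V i) →
      (T * l.prod).trace = 0) :
    chernForm ι n (Fin.cons T V) = 0 := by
  rw [chernForm_eq_sum, Finset.sum_eq_zero, mul_zero]
  intro σ _
  have key : (List.ofFn fun i => (Fin.cons T V : Fin (2 * n + 1) → Matrix ι ι ℂ) (σ i)).prod.trace
      = 0 := by
    set a : Fin (2 * n + 1) → Matrix ι ι ℂ := Fin.cons T V with ha
    set L := List.ofFn fun i => a (σ i) with hL
    set k : Fin (2 * n + 1) := σ.symm 0 with hk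
    have hlen : L.length = 2 * n + 1 := by simp [hL]
    have hkL : (k : ℕ) < L.length := by rw [hlen]; exact k.2
    have hget : L[(k : ℕ)] = T := by simp [hL, hk, ha, -List.ofFn_succ]
    have hsplit : L = L.take k ++ T :: L.drop (k + 1) := by
      rw [← hget, ← List.drop_eq_getElem_cons hkL, List.take_append_drop]
    have hmem : ∀ j (hj : j < L.length), j ≠ (k : ℕ) → ∃ i, L[j] = V i := by
      intro j hj hjk
      have h0 : σ ⟨j, by rw [← hlen]; exact hj⟩ ≠ 0 := by
        intro h0
        apply hjk
        have := congrArg Fin.val ((Equiv.eq_symm_apply σ).2 h0)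
        simpa using this
      obtain ⟨i, hi⟩ := Fin.exists_succ_eq.2 h0
      refine ⟨i, ?_⟩
      simp [hL, ← hi, ha, -List.ofFn_succ]
    rw [hsplit, List.prod_append, List.prod_cons, Matrix.trace_mul_comm, Matrix.mul_assoc,
      ← List.prod_append]
    apply h
    · simp; omega
    · intro B hB
      rcases List.mem_append.1 hB with hB | hB
      · obtain ⟨j, hj, rfl⟩ := List.mem_iff_getElem.1 hB
        have hj' := hj
        rw [List.length_drop] at hj'
        rw [List.getElem_drop]
        exact hmem _ _ (by omega)
      · obtain ⟨j, hj, rfl⟩ := List.mem_iff_getElem.1 hB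
        have hj' := hj
        rw [List.length_take] at hj'
        rw [List.getElem_take]
        exact hmem _ _ (by omega)
  rw [key, smul_zero]

theorem prod_map_conj {S S' : Matrix ι ι ℂ} (h : S' * S = 1) (h' : S * S' = 1)
    (l : List (Matrix ι ι ℂ)) : (l.map fun B => S * B * S').prod = S * l.prod * S' := by
  induction l with
  | nil => simp [h']
  | cons B l ih =>
    rw [List.map_cons, List.prod_cons, List.prod_cons, ih]
    calc S * B * S' * (S * l.prod * S') = S * B * (S' * S) * l.prod * S' := by noncomm_ring
      _ = S * (B * l.prod) * S' := by rw [h]; noncomm_ring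

theorem chernForm_conj (n : ℕ) {S S' : Matrix ι ι ℂ} (h : S' * S = 1) (h' : S * S' = 1)
    (a : Fin (2 * n + 1) → Matrix ι ι ℂ) :
    (chernForm ι n fun i => S * a i * S') = chernForm ι n a := by
  rw [chernForm_eq_sum, chernForm_eq_sum]
  congr 1
  refine Finset.sum_congr rfl fun σ _ => ?_
  have : (List.ofFn fun i => S * a (σ i) * S') =
      (List.ofFn fun i => a (σ i)).map fun B => S * B * S' := by
    rw [List.map_ofFn]; rfl
  rw [this, prod_map_conj h h', Matrix.trace_mul_comm, ← Matrix.mul_assoc, h, Matrix.one_mul]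

theorem continuousOn_chernForm {X : Type*} [TopologicalSpace X] {s : Set X} (n : ℕ)
    (a : Fin (2 * n + 1) → X → Matrix ι ι ℂ) (h : ∀ i, ContinuousOn (a i) s) :
    ContinuousOn (fun t => chernForm ι n fun i => a i t) s := by
  simp only [chernForm_eq_sum]
  refine continuousOn_const.mul (continuousOn_finsetSum _ fun σ _ => ?_)
  have hc : ContinuousOn (fun t => (List.ofFn fun i => a (σ i) t).prod) s := by
    have := continuousOn_list_prod (f := fun i t => a (σ i) t) (List.finRange (2 * n + 1))
      (t := s) fun i _ => h (σ i)
    refine this.congr fun t _ => ?_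
    rw [List.ofFn_eq_map]
  have ht : ContinuousOn (fun t => (List.ofFn fun i => a (σ i) t).prod.trace) s :=
    (Continuous.matrix_trace continuous_id).comp_continuousOn hc
  rcases Int.units_eq_one_or (Equiv.Perm.sign σ) with h | h
  · simpa [h, -List.ofFn_succ] using ht
  · simpa [h, -List.ofFn_succ, Pi.neg_def] using ht.neg

/-! ### Block matrices indexed by `Fin (m + n)` -/

/-- The block matrix with blocks `A`, `B`, `C`, `D`. -/
def blk {m n : ℕ} (A : Matrix (Fin m) (Fin m) ℂ) (B : Matrix (Fin m) (Fin n) ℂ)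
    (C : Matrix (Fin n) (Fin m) ℂ) (D : Matrix (Fin n) (Fin n) ℂ) :
    Matrix (Fin (m + n)) (Fin (m + n)) ℂ :=
  Matrix.reindex finSumFinEquiv finSumFinEquiv (Matrix.fromBlocks A B C D)

variable {m n : ℕ}

theorem blk_mul (A A' : Matrix (Fin m) (Fin m) ℂ) (B B' : Matrix (Fin m) (Fin n) ℂ)
    (C C' : Matrix (Fin n) (Fin m) ℂ) (D D' : Matrix (Fin n) (Fin n) ℂ) :
    blk A B C D * blk A' B' C' D' =
      blk (A * A' + B * C') (A * B' + B * D') (C * A' + D * C') (C * B' + D * D') := by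
  rw [blk, blk, Matrix.reindex_apply, Matrix.reindex_apply, Matrix.submatrix_mul_equiv,
    Matrix.fromBlocks_multiply]
  rfl

theorem blk_add (A A' : Matrix (Fin m) (Fin m) ℂ) (B B' : Matrix (Fin m) (Fin n) ℂ)
    (C C' : Matrix (Fin n) (Fin m) ℂ) (D D' : Matrix (Fin n) (Fin n) ℂ) :
    blk A B C D + blk A' B' C' D' = blk (A + A') (B + B') (C + C') (D + D') := by
  simp only [blk, Matrix.reindex_apply, ← Matrix.fromBlocks_add, Matrix.submatrix_add]
  rfl

theorem blk_smul (c : ℂ) (A : Matrix (Fin m) (Fin m) ℂ) (B : Matrix (Fin m) (Fin n) ℂ)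
    (C : Matrix (Fin n) (Fin m) ℂ) (D : Matrix (Fin n) (Fin n) ℂ) :
    c • blk A B C D = blk (c • A) (c • B) (c • C) (c • D) := by
  simp only [blk, Matrix.reindex_apply, ← Matrix.fromBlocks_smul, Matrix.submatrix_smul]
  rfl

theorem blk_sub (A A' : Matrix (Fin m) (Fin m) ℂ) (B B' : Matrix (Fin m) (Fin n) ℂ)
    (C C' : Matrix (Fin n) (Fin m) ℂ) (D D' : Matrix (Fin n) (Fin n) ℂ) :
    blk A B C D - blk A' B' C' D' = blk (A - A') (B - B') (C - C') (D - D') := by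
  rw [sub_eq_add_neg, ← neg_one_smul ℂ (blk A' B' C' D'), blk_smul, blk_add]
  simp [sub_eq_add_neg]

theorem blk_one : blk (1 : Matrix (Fin m) (Fin m) ℂ) 0 0 (1 : Matrix (Fin n) (Fin n) ℂ) = 1 := by
  simp [blk]

theorem blk_star (A : Matrix (Fin m) (Fin m) ℂ) (B : Matrix (Fin m) (Fin n) ℂ)
    (C : Matrix (Fin n) (Fin m) ℂ) (D : Matrix (Fin n) (Fin n) ℂ) :
    star (blk A B C D) = blk (Aᴴ) (Cᴴ) (Bᴴ) (Dᴴ) := by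
  simp [blk, Matrix.star_eq_conjTranspose, Matrix.conjTranspose_submatrix,
    Matrix.fromBlocks_conjTranspose]

theorem blk_trace (A : Matrix (Fin m) (Fin m) ℂ) (B : Matrix (Fin m) (Fin n) ℂ)
    (C : Matrix (Fin n) (Fin m) ℂ) (D : Matrix (Fin n) (Fin n) ℂ) :
    (blk A B C D).trace = A.trace + D.trace := by
  simp only [Matrix.trace, blk, Fin.sum_univ_add, Matrix.diag_apply]
  simp

theorem prod_ofFn_blk {k : ℕ} (a : Fin k → Matrix (Fin m) (Fin m) ℂ)
    (b : Fin k → Matrix (Fin n) (Fin n) ℂ) :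
    (List.ofFn fun i => blk (a i) 0 0 (b i)).prod =
      blk (List.ofFn a).prod 0 0 (List.ofFn b).prod := by
  induction k with
  | zero => simp [blk_one]
  | succ k ih =>
    simp only [List.ofFn_succ, List.prod_cons]
    rw [ih (fun i => a i.succ) fun i => b i.succ, blk_mul]
    simp

theorem chernForm_blk (k : ℕ) (a : Fin (2 * k + 1) → Matrix (Fin m) (Fin m) ℂ)
    (b : Fin (2 * k + 1) → Matrix (Fin n) (Fin n) ℂ) :
    (chernForm (Fin (m + n)) k fun i => blk (a i) 0 0 (b i)) =
      chernForm (Fin m) k a + chernForm (Fin n) k b := by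
  simp only [chernForm_eq_sum]
  rw [← mul_add, ← Finset.sum_add_distrib]
  congr 1
  refine Finset.sum_congr rfl fun σ _ => ?_
  rw [prod_ofFn_blk (fun i => a (σ i)) fun i => b (σ i), blk_trace, smul_add]

end Algebra

section Calculus

open Matrix

variable {F : Type*} [NormedAddCommGroup F] [NormedSpace ℝ F]
  {K : Type*} [TopologicalSpace K] {J : ModelWithCorners ℝ F K}
  {N : Type*} [TopologicalSpace N] [ChartedSpace K N]
  {s : Set N} {p : N} {ι κ μ : Type}

variable (J s p) in
/-- The matrix valued function `A` is entrywise differentiable at `p` within `s`, with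
differential `A'`. -/
def HasEntryDeriv (A : N → Matrix ι κ ℂ) (A' : TangentSpace J p → Matrix ι κ ℂ) : Prop :=
  ∀ i j, ∃ L : TangentSpace J p →L[ℝ] ℂ,
    HasMFDerivWithinAt J 𝓘(ℝ, ℂ) (fun q => A q i j) s p L ∧ ∀ w, L w = A' w i j

theorem HasEntryDeriv.congr_of_eventuallyEq {A B : N → Matrix ι κ ℂ}
    {A' : TangentSpace J p → Matrix ι κ ℂ} (h : HasEntryDeriv J s p A A')
    (h₁ : ∀ᶠ q in nhdsWithin p s, B q = A q) (hp : B p = A p) : HasEntryDeriv J s p B A' := by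
  intro i j
  obtain ⟨L, hL, hL'⟩ := h i j
  refine ⟨L, hL.congr_of_eventuallyEq ?_ (by rw [hp]), hL'⟩
  filter_upwards [h₁] with q hq
  rw [hq]

theorem HasEntryDeriv.eq {A : N → Matrix ι κ ℂ} {A' A'' : TangentSpace J p → Matrix ι κ ℂ}
    (h : HasEntryDeriv J s p A A') (h' : HasEntryDeriv J s p A A'')
    (hs : UniqueMDiffWithinAt J s p) (w : TangentSpace J p) : A' w = A'' w := by
  ext i j
  obtain ⟨L, hL, e⟩ := h i j
  obtain ⟨L', hL', e'⟩ := h' i j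
  rw [← e, ← e', hs.eq hL hL']

theorem hasEntryDeriv_const (A : Matrix ι κ ℂ) : HasEntryDeriv J s p (fun _ => A) fun _ => 0 :=
  fun i j => ⟨0, hasMFDerivWithinAt_const (A i j) s p, fun _ => rfl⟩

theorem HasEntryDeriv.mul [Fintype κ] {A : N → Matrix ι κ ℂ} {B : N → Matrix κ μ ℂ}
    {A' : TangentSpace J p → Matrix ι κ ℂ} {B' : TangentSpace J p → Matrix κ μ ℂ}
    (hA : HasEntryDeriv J s p A A') (hB : HasEntryDeriv J s p B B') :
    HasEntryDeriv J s p (fun q => A q * B q) fun w => A' w * B p + A p * B' w := by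
  intro i j
  choose LA hLA eA using hA
  choose LB hLB eB using hB
  refine ⟨∑ k, (A p i k • LB k j + B p k j • LA i k), ?_, fun w => ?_⟩
  · have hk : ∀ k ∈ Finset.univ, HasMFDerivWithinAt J 𝓘(ℝ, ℂ)
        ((fun q => A q i k) * fun q => B q k j) s p
        (A p i k • LB k j + B p k j • LA i k : F →L[ℝ] ℂ) :=
      fun k _ => (hLA i k).mul (hLB k j)
    have hf : (∑ k, (fun q => A q i k) * fun q => B q k j) = fun q => (A q * B q) i j := by
      ext q
      simp [Matrix.mul_apply]
    rw [← hf]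
    exact HasMFDerivWithinAt.sum hk
  · rw [_root_.sum_apply]
    simp only [Matrix.add_apply, Matrix.mul_apply, ← Finset.sum_add_distrib, ← eA, ← eB]
    refine Finset.sum_congr rfl fun k _ => ?_
    change A p i k * LB k j w + B p k j * LA i k w = _
    ring

theorem HasEntryDeriv.conjTranspose {A : N → Matrix ι κ ℂ} {A' : TangentSpace J p → Matrix ι κ ℂ}
    (hA : HasEntryDeriv J s p A A') : HasEntryDeriv J s p (fun q => (A q)ᴴ) fun w => (A' w)ᴴ := by
  intro i j
  obtain ⟨L, hL, e⟩ := hA j i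
  refine ⟨(Complex.conjCLE : ℂ →L[ℝ] ℂ).comp L, ?_, fun w => ?_⟩
  · exact (Complex.conjCLE : ℂ →L[ℝ] ℂ).hasMFDerivAt.comp_hasMFDerivWithinAt p hL
  · exact congrArg (starRingEnd ℂ) (e w)

theorem exists_hasMFDerivWithinAt_congr {f f' : N → ℂ} {z z' : TangentSpace J p → ℂ}
    (h : ∃ L : TangentSpace J p →L[ℝ] ℂ, HasMFDerivWithinAt J 𝓘(ℝ, ℂ) f s p L ∧ ∀ w, L w = z w)
    (hf : f' = f) (hz : z' = z) :
    ∃ L : TangentSpace J p →L[ℝ] ℂ, HasMFDerivWithinAt J 𝓘(ℝ, ℂ) f' s p L ∧ ∀ w, L w = z' w := by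
  subst hf hz
  exact h

theorem HasEntryDeriv.blk {m n : ℕ} {A : N → Matrix (Fin m) (Fin m) ℂ}
    {B : N → Matrix (Fin m) (Fin n) ℂ} {C : N → Matrix (Fin n) (Fin m) ℂ}
    {D : N → Matrix (Fin n) (Fin n) ℂ} {A' B' C' D'}
    (hA : HasEntryDeriv J s p A A') (hB : HasEntryDeriv J s p B B')
    (hC : HasEntryDeriv J s p C C') (hD : HasEntryDeriv J s p D D') :
    HasEntryDeriv J s p (fun q => blk (A q) (B q) (C q) (D q))
      fun w => blk (A' w) (B' w) (C' w) (D' w) := by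
  intro i j
  obtain ⟨i, rfl⟩ := finSumFinEquiv.surjective i
  obtain ⟨j, rfl⟩ := finSumFinEquiv.surjective j
  rcases i with a | a <;> rcases j with b | b
  · exact exists_hasMFDerivWithinAt_congr (hA a b)
      (by ext; simp [OddDiffK.blk]) (by ext; simp [OddDiffK.blk])
  · exact exists_hasMFDerivWithinAt_congr (hB a b)
      (by ext; simp [OddDiffK.blk]) (by ext; simp [OddDiffK.blk])
  · exact exists_hasMFDerivWithinAt_congr (hC a b)
      (by ext; simp [OddDiffK.blk]) (by ext; simp [OddDiffK.blk])
  · exact exists_hasMFDerivWithinAt_congr (hD a b)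
      (by ext; simp [OddDiffK.blk]) (by ext; simp [OddDiffK.blk])

variable [Fintype ι] [DecidableEq ι]

/-- The matrix of the differentials of the entries of `g`. -/
def entryMat (J : ModelWithCorners ℝ F K) (s : Set N) (g : N → Matrix.unitaryGroup ι ℂ) (p : N)
    (w : TangentSpace J p) : Matrix ι ι ℂ :=
  Matrix.of fun i j => entryDiff J s g p i j w

theorem hasEntryDeriv_entryMat {g : N → Matrix.unitaryGroup ι ℂ}
    (hg : ∀ i j, MDifferentiableWithinAt J 𝓘(ℝ, ℂ) (fun q => (g q).1 i j) s p) :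
    HasEntryDeriv J s p (fun q => (g q).1) (entryMat J s g p) :=
  fun i j => ⟨entryDiff J s g p i j, (hg i j).hasMFDerivWithinAt, fun _ => rfl⟩

theorem HasEntryDeriv.entryMat_eq {g : N → Matrix.unitaryGroup ι ℂ}
    {A' : TangentSpace J p → Matrix ι ι ℂ} (h : HasEntryDeriv J s p (fun q => (g q).1) A')
    (hs : UniqueMDiffWithinAt J s p) (w : TangentSpace J p) : entryMat J s g p w = A' w := by
  ext i j
  obtain ⟨L, hL, e⟩ := h i j
  rw [← e]
  exact congrArg (fun l : F →L[ℝ] ℂ => l w) (hL.mfderivWithin hs)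

theorem maurerCartan_eq (g : N → Matrix.unitaryGroup ι ℂ) (w : TangentSpace J p) :
    maurerCartan J s g p w = star (g p).1 * entryMat J s g p w := rfl

theorem HasEntryDeriv.maurerCartan_eq {g : N → Matrix.unitaryGroup ι ℂ}
    {A' : TangentSpace J p → Matrix ι ι ℂ} (h : HasEntryDeriv J s p (fun q => (g q).1) A')
    (hs : UniqueMDiffWithinAt J s p) (w : TangentSpace J p) :
    maurerCartan J s g p w = star (g p).1 * A' w := by
  rw [OddDiffK.maurerCartan_eq, h.entryMat_eq hs]

theorem unitary_star_mul (A : Matrix.unitaryGroup ι ℂ) : star A.1 * A.1 = 1 :=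
  Matrix.mem_unitaryGroup_iff'.1 A.2

theorem unitary_mul_star (A : Matrix.unitaryGroup ι ℂ) : A.1 * star A.1 = 1 :=
  Matrix.mem_unitaryGroup_iff.1 A.2

end Calculus

section Cylinder

variable {E : Type*} [NormedAddCommGroup E] [NormedSpace ℝ E]
  {H : Type*} [TopologicalSpace H] {I : ModelWithCorners ℝ E H}
  {M : Type*} [TopologicalSpace M] [ChartedSpace H M] {ι κ : Type}

theorem uniqueMDiffWithinAt_cylinder {x : M} {t : ℝ} (ht : t ∈ Set.Icc (0 : ℝ) 1) :
    UniqueMDiffWithinAt (I.prod 𝓘(ℝ, ℝ)) (cylinder M) (x, t) :=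
  (uniqueMDiffOn_univ.prod (uniqueDiffOn_Icc zero_lt_one).uniqueMDiffOn) (x, t) ⟨trivial, ht⟩

theorem HasEntryDeriv.comp_fst {A : M → Matrix ι κ ℂ} {x : M} {t : ℝ}
    {A' : TangentSpace I x → Matrix ι κ ℂ} (h : HasEntryDeriv I Set.univ x A A') :
    HasEntryDeriv (I.prod 𝓘(ℝ, ℝ)) (cylinder M) (x, t) (fun q => A q.1)
      fun w : E × ℝ => A' w.1 := by
  intro i j
  obtain ⟨L, hL, e⟩ := h i j
  refine ⟨L.comp (ContinuousLinearMap.fst ℝ E ℝ), ?_, fun w => e w.1⟩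
  exact hL.comp (x, t)
    (hasMFDerivWithinAt_fst (I := I) (I' := 𝓘(ℝ, ℝ)) (cylinder M) (x, t)) fun _ _ => Set.mem_univ _

theorem hasEntryDeriv_snd {A : ℝ → Matrix ι κ ℂ} {A' : Matrix ι κ ℂ} {x : M} {t : ℝ}
    (h : ∀ i j, HasDerivAt (fun u => A u i j) (A' i j) t) :
    HasEntryDeriv (I.prod 𝓘(ℝ, ℝ)) (cylinder M) (x, t) (fun q => A q.2)
      fun w : E × ℝ => w.2 • A' := by
  intro i j
  have hL := (h i j).hasFDerivAt.hasMFDerivAt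
  refine ⟨(ContinuousLinearMap.toSpanSingleton ℝ (A' i j)).comp (ContinuousLinearMap.snd ℝ E ℝ),
    hL.comp_hasMFDerivWithinAt (x, t) (hasMFDerivWithinAt_snd (cylinder M) (x, t)), fun w => ?_⟩
  rfl

theorem HasEntryDeriv.reparam {A : M × ℝ → Matrix ι κ ℂ} {x : M} {t : ℝ} {φ : ℝ → ℝ} {φ' : ℝ}
    {A' : TangentSpace (I.prod 𝓘(ℝ, ℝ)) (x, φ t) → Matrix ι κ ℂ}
    (h : HasEntryDeriv (I.prod 𝓘(ℝ, ℝ)) (cylinder M) (x, φ t) A A')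
    (hφ : HasDerivAt φ φ' t) (hm : Set.MapsTo φ (Set.Icc 0 1) (Set.Icc 0 1)) :
    HasEntryDeriv (I.prod 𝓘(ℝ, ℝ)) (cylinder M) (x, t) (fun q => A (q.1, φ q.2))
      fun w : E × ℝ => A' (w.1, w.2 * φ') := by
  intro i j
  obtain ⟨L, hL, e⟩ := h i j
  have h₁ := hφ.hasFDerivAt.hasMFDerivAt.comp_hasMFDerivWithinAt (x, t)
    (hasMFDerivWithinAt_snd (I := I) (I' := 𝓘(ℝ, ℝ)) (cylinder M) (x, t))
  have h₂ := (hasMFDerivWithinAt_fst (I := I) (I' := 𝓘(ℝ, ℝ)) (cylinder M) (x, t)).prodMk h₁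
  refine ⟨_, HasMFDerivWithinAt.comp (x, t) (g := fun q => A q i j) hL h₂ ?_, fun w => ?_⟩
  · rintro ⟨y, u⟩ ⟨_, hu⟩
    exact ⟨trivial, hm hu⟩
  · exact e (w.1, w.2 * φ')

end Cylinder

section Paths

open Matrix

variable {E : Type*} [NormedAddCommGroup E] [NormedSpace ℝ E]
  {H : Type*} [TopologicalSpace H] {I : ModelWithCorners ℝ E H}
  {M : Type*} [TopologicalSpace M] [ChartedSpace H M] {m n k : ℕ}

/-- A function on the cylinder `M × [0,1]` that is smooth has differentials, in fixed directions,
that depend continuously on the time. -/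
theorem continuousOn_mfderivWithin_cylinder [IsManifold I ∞ M] {f : M × ℝ → ℂ}
    (hf : ContMDiffOn (I.prod 𝓘(ℝ, ℝ)) 𝓘(ℝ, ℂ) ∞ f (cylinder M)) (x : M) (w : E × ℝ) :
    ContinuousOn (fun t : ℝ => (mfderivWithin (I.prod 𝓘(ℝ, ℝ)) 𝓘(ℝ, ℂ) f (cylinder M) (x, t) :
      E × ℝ →L[ℝ] ℂ) w) (Set.Icc 0 1) := by
  set e := extChartAt I x with he
  set S : Set (E × ℝ) := e.target ×ˢ Set.Icc (0 : ℝ) 1 with hS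
  set g : E × ℝ → ℂ := fun y => f (e.symm y.1, y.2) with hg
  have hSu : UniqueDiffOn ℝ S :=
    (uniqueDiffOn_extChartAt_target x).prod (uniqueDiffOn_Icc zero_lt_one)
  have hgS : ContDiffOn ℝ ∞ g S := by
    rw [← contMDiffOn_iff_contDiffOn]
    have h₁ : ContMDiffOn 𝓘(ℝ, E × ℝ) (I.prod 𝓘(ℝ, ℝ)) ∞
        (fun y : E × ℝ => (e.symm y.1, y.2)) S :=
      ((contMDiffOn_extChartAt_symm x).comp contDiff_fst.contMDiff.contMDiffOn
        fun y hy => hy.1).prodMk contDiff_snd.contMDiff.contMDiffOn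
    exact hf.comp h₁ fun y hy => ⟨trivial, hy.2⟩
  have hD := (mdifferentiableAt_extChartAt (I := I) (mem_chart_source H x)).hasMFDerivAt
  set D : E →L[ℝ] E := mfderiv I 𝓘(ℝ, E) (extChartAt I x) x with hDdef
  have key : ∀ t ∈ Set.Icc (0 : ℝ) 1,
      (mfderivWithin (I.prod 𝓘(ℝ, ℝ)) 𝓘(ℝ, ℂ) f (cylinder M) (x, t) : E × ℝ →L[ℝ] ℂ) w =
        fderivWithin ℝ g S (e x, t) (D w.1, w.2) := by
    intro t ht
    have hmem : (e x, t) ∈ S := ⟨mem_extChartAt_target x, ht⟩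
    have h₁ : HasMFDerivWithinAt 𝓘(ℝ, E × ℝ) 𝓘(ℝ, ℂ) g S (e x, t) (fderivWithin ℝ g S (e x, t)) :=
      ((hgS.differentiableOn (by simp)) _ hmem).hasFDerivWithinAt.hasMFDerivWithinAt
    have h₂ : HasMFDerivWithinAt (I.prod 𝓘(ℝ, ℝ)) 𝓘(ℝ, E) (fun q : M × ℝ => e q.1) (cylinder M)
        (x, t) (D.comp (ContinuousLinearMap.fst ℝ E ℝ)) :=
      hD.comp_hasMFDerivWithinAt (x, t)
        (hasMFDerivWithinAt_fst (I := I) (I' := 𝓘(ℝ, ℝ)) (cylinder M) (x, t))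
    have h₃ : HasMFDerivWithinAt (I.prod 𝓘(ℝ, ℝ)) 𝓘(ℝ, E × ℝ) (fun q : M × ℝ => (e q.1, q.2))
        (cylinder M) (x, t) ((D.comp (ContinuousLinearMap.fst ℝ E ℝ)).prod
          (ContinuousLinearMap.snd ℝ E ℝ)) := by
      rw [modelWithCornersSelf_prod, ← chartedSpaceSelf_prod]
      exact HasMFDerivWithinAt.prodMk h₂
        (hasMFDerivWithinAt_snd (I := I) (I' := 𝓘(ℝ, ℝ)) (cylinder M) (x, t))
    have hnhds : Prod.fst ⁻¹' e.source ∈ nhds (x, t) :=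
      continuousAt_fst.preimage_mem_nhds (extChartAt_source_mem_nhds x)
    have hmaps : cylinder M ∩ Prod.fst ⁻¹' e.source ⊆ (fun q : M × ℝ => (e q.1, q.2)) ⁻¹' S :=
      fun q hq => ⟨e.map_source hq.2, hq.1.2⟩
    have h₄ := HasMFDerivWithinAt.comp (x, t) h₁ (h₃.mono Set.inter_subset_left) hmaps
    have h₅ := (hasMFDerivWithinAt_inter hnhds).1 h₄
    have h₆ := h₅.congr_of_eventuallyEq (f₁ := f) (by
      filter_upwards [mem_nhdsWithin_of_mem_nhds hnhds] with q hq
      simp only [hg, Function.comp_apply]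
      rw [e.left_inv hq]) (by
      simp only [hg, Function.comp_apply]
      rw [e.left_inv (mem_extChartAt_source x)])
    exact congrArg (fun l : E × ℝ →L[ℝ] ℂ => l w)
      (h₆.mfderivWithin (uniqueMDiffWithinAt_cylinder ht))
  refine ContinuousOn.congr ?_ key
  have hc : ContinuousOn (fun t : ℝ => fderivWithin ℝ g S (e x, t)) (Set.Icc 0 1) :=
    (hgS.continuousOn_fderivWithin hSu (by simp)).comp
      (Continuous.continuousOn (by fun_prop)) fun t ht => ⟨mem_extChartAt_target x, ht⟩
  exact hc.clm_apply continuousOn_const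

/-- `γ⁻¹ dγ` at `(x, t)`. -/
def UPath.mc (γ : UPath I M n) (x : M) (t : ℝ) (w : E × ℝ) : Matrix (Fin n) (Fin n) ℂ :=
  maurerCartan (I.prod 𝓘(ℝ, ℝ)) (cylinder M) γ.toFun (x, t) w

/-- The integrand of the Chern-Simons form. -/
def UPath.integrand (γ : UPath I M n) (k : ℕ) (x : M) (v : Fin (2 * k) → E) (t : ℝ) : ℂ :=
  chernForm (Fin n) k (Fin.cons (γ.mc x t (0, 1)) fun i => γ.mc x t (v i, 0))

theorem UPath.CS_apply (γ : UPath I M n) (k : ℕ) (x : M) (v : Fin (2 * k) → TangentSpace I x) :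
    γ.CS k x v = ∫ t in (0 : ℝ)..1, γ.integrand k x v t := by
  unfold UPath.CS
  congr 1
  ext t
  rw [oddChern_apply]
  change _ = chernForm (Fin n) k (Fin.cons (γ.mc x t (0, 1)) fun i => γ.mc x t (v i, 0))
  congr 1
  ext i
  refine Fin.cases ?_ (fun i => ?_) i <;> rfl

theorem UPath.hasEntryDeriv (γ : UPath I M n) (x : M) {t : ℝ} (ht : t ∈ Set.Icc (0 : ℝ) 1) :
    HasEntryDeriv (I.prod 𝓘(ℝ, ℝ)) (cylinder M) (x, t) (fun q => (γ.toFun q).1)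
      (entryMat (I.prod 𝓘(ℝ, ℝ)) (cylinder M) γ.toFun (x, t)) :=
  hasEntryDeriv_entryMat fun i j =>
    ((γ.smooth i j) (x, t) ⟨trivial, ht⟩).mdifferentiableWithinAt (by simp)

theorem UPath.mc_eq (γ : UPath I M n) {x : M} {t : ℝ} (ht : t ∈ Set.Icc (0 : ℝ) 1)
    {A' : E × ℝ → Matrix (Fin n) (Fin n) ℂ}
    (h : HasEntryDeriv (I.prod 𝓘(ℝ, ℝ)) (cylinder M) (x, t) (fun q => (γ.toFun q).1) A')
    (w : E × ℝ) : γ.mc x t w = star (γ.toFun (x, t)).1 * A' w :=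
  h.maurerCartan_eq (uniqueMDiffWithinAt_cylinder ht) w

theorem UPath.continuousOn_integrand [IsManifold I ∞ M] (γ : UPath I M n) (k : ℕ) (x : M)
    (v : Fin (2 * k) → E) : ContinuousOn (γ.integrand k x v) (Set.Icc 0 1) := by
  have hγ : ContinuousOn (fun t : ℝ => (γ.toFun (x, t)).1) (Set.Icc 0 1) := by
    refine continuousOn_pi.2 fun i => continuousOn_pi.2 fun j => ?_
    exact (γ.smooth i j).continuousOn.comp (Continuous.continuousOn (by fun_prop))
      fun t ht => ⟨trivial, ht⟩
  have hmc : ∀ w, ContinuousOn (fun t => γ.mc x t w) (Set.Icc 0 1) := by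
    intro w
    have he : ContinuousOn (fun t : ℝ => entryMat (I.prod 𝓘(ℝ, ℝ)) (cylinder M) γ.toFun (x, t) w)
        (Set.Icc 0 1) :=
      continuousOn_pi.2 fun i => continuousOn_pi.2 fun j =>
        continuousOn_mfderivWithin_cylinder (γ.smooth i j) x w
    exact (continuous_star.comp_continuousOn hγ).mul he
  have := continuousOn_chernForm k (s := Set.Icc (0 : ℝ) 1)
    (fun i t => (Fin.cons (γ.mc x t (0, 1)) fun i => γ.mc x t (v i, 0) :
      Fin (2 * k + 1) → Matrix (Fin n) (Fin n) ℂ) i)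
    (Fin.cases (hmc _) fun i => hmc _)
  exact this

/-! ### Constant paths and block sums of paths -/

/-- The constant path at `g`. -/
def UPath.const (g : UMap I M n) : UPath I M n where
  toFun p := g.toFun p.1
  smooth i j := ((g.smooth i j).comp contMDiff_fst).contMDiffOn

theorem UMap.hasEntryDeriv (g : UMap I M n) (x : M) :
    HasEntryDeriv I Set.univ x (fun q => (g.toFun q).1) (entryMat I Set.univ g.toFun x) :=
  hasEntryDeriv_entryMat fun i j =>
    (((g.smooth i j) x).mdifferentiableAt (by simp)).mdifferentiableWithinAt

theorem entryMat_zero (g : UMap I M n) (x : M) : entryMat I Set.univ g.toFun x 0 = 0 := by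
  ext i j
  exact map_zero (entryDiff I Set.univ g.toFun x i j)

theorem UPath.integrand_const (g : UMap I M n) (k : ℕ) (x : M) (v : Fin (2 * k) → E) {t : ℝ}
    (ht : t ∈ Set.Icc (0 : ℝ) 1) : (UPath.const g).integrand k x v t = 0 := by
  have h := ((UPath.const g).mc_eq ht ((g.hasEntryDeriv x).comp_fst (t := t)) (0, 1)).trans
    ((congrArg _ (entryMat_zero g x)).trans (mul_zero _))
  rw [UPath.integrand, h, chernForm_cons_zero]

theorem UPath.CS_eq_zero (γ : UPath I M n)
    (h : ∀ k x v, ∀ t ∈ Set.Icc (0 : ℝ) 1, γ.integrand k x v t = 0) : γ.CS = 0 := by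
  ext k x v
  rw [UPath.CS_apply, intervalIntegral.integral_congr (g := fun _ => 0)]
  · simp
  · intro t ht
    rw [Set.uIcc_of_le zero_le_one] at ht
    exact h k x v t ht

theorem UPath.CS_congr {γ : UPath I M m} {δ : UPath I M n}
    (h : ∀ k x v, ∀ t ∈ Set.Icc (0 : ℝ) 1, γ.integrand k x v t = δ.integrand k x v t) :
    γ.CS = δ.CS := by
  ext k x v
  rw [UPath.CS_apply, UPath.CS_apply]
  refine intervalIntegral.integral_congr fun t ht => ?_
  rw [Set.uIcc_of_le zero_le_one] at ht
  exact h k x v t ht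

theorem UPath.CS_const (g : UMap I M n) : (UPath.const g).CS = 0 :=
  UPath.CS_eq_zero _ fun k x v _ ht => UPath.integrand_const g k x v ht

/-- The block sum of paths. -/
def UPath.blockSum (γ : UPath I M m) (δ : UPath I M n) : UPath I M (m + n) where
  toFun p := OddDiffK.blockSum (γ.toFun p) (δ.toFun p)
  smooth i j := by
    rcases hi : finSumFinEquiv.symm i with a | a <;> rcases hj : finSumFinEquiv.symm j with b | b <;>
      simp only [OddDiffK.blockSum, Matrix.reindex_apply, Matrix.submatrix_apply, hi, hj,
        Matrix.fromBlocks_apply₁₁, Matrix.fromBlocks_apply₁₂, Matrix.fromBlocks_apply₂₁,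
        Matrix.fromBlocks_apply₂₂, Matrix.zero_apply]
    exacts [γ.smooth a b, contMDiffOn_const, contMDiffOn_const, δ.smooth a b]

theorem blockSum_coe (A : Matrix.unitaryGroup (Fin m) ℂ) (B : Matrix.unitaryGroup (Fin n) ℂ) :
    (blockSum A B).1 = blk A.1 0 0 B.1 := rfl

theorem UPath.integrand_blockSum (γ : UPath I M m) (δ : UPath I M n) (k : ℕ) (x : M)
    (v : Fin (2 * k) → E) {t : ℝ} (ht : t ∈ Set.Icc (0 : ℝ) 1) :
    (γ.blockSum δ).integrand k x v t = γ.integrand k x v t + δ.integrand k x v t := by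
  have h := (γ.blockSum δ).mc_eq ht ((γ.hasEntryDeriv x ht).blk (hasEntryDeriv_const 0)
    (hasEntryDeriv_const 0) (δ.hasEntryDeriv x ht))
  have h' : ∀ w, (γ.blockSum δ).mc x t w = blk (γ.mc x t w) 0 0 (δ.mc x t w) := by
    intro w
    rw [h w]
    change star (blk (γ.toFun (x, t)).1 0 0 (δ.toFun (x, t)).1) * _ = _
    rw [blk_star, blk_mul]
    simp only [Matrix.mul_zero, Matrix.zero_mul, add_zero, zero_add, Matrix.conjTranspose_zero]
    rfl
  rw [UPath.integrand, UPath.integrand, UPath.integrand, ← chernForm_blk]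
  congr 1
  ext i : 1
  refine Fin.cases ?_ (fun i => ?_) i <;> simp [h']

theorem UPath.CS_blockSum_const (γ : UPath I M m) (g : UMap I M n) :
    (γ.blockSum (UPath.const g)).CS = γ.CS :=
  UPath.CS_congr fun k x v t ht => by
    rw [UPath.integrand_blockSum _ _ _ _ _ ht, UPath.integrand_const _ _ _ _ ht, add_zero]

theorem UPath.CS_const_blockSum (g : UMap I M m) (γ : UPath I M n) :
    ((UPath.const g).blockSum γ).CS = γ.CS :=
  UPath.CS_congr fun k x v t ht => by
    rw [UPath.integrand_blockSum _ _ _ _ _ ht, UPath.integrand_const _ _ _ _ ht, zero_add]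

/-! ### Reparametrized paths -/

/-- The path `t ↦ γ (φ t)`. -/
def UPath.reparam (γ : UPath I M n) (φ : ℝ → ℝ) (hφ : ContDiff ℝ ∞ φ)
    (hm : Set.MapsTo φ (Set.Icc 0 1) (Set.Icc 0 1)) : UPath I M n where
  toFun p := γ.toFun (p.1, φ p.2)
  smooth i j := (γ.smooth i j).comp
    (contMDiff_fst.prodMk (hφ.contMDiff.comp contMDiff_snd)).contMDiffOn
    fun _ hp => ⟨trivial, hm hp.2⟩

theorem UPath.integrand_reparam (γ : UPath I M n) {φ : ℝ → ℝ} (hφ : ContDiff ℝ ∞ φ)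
    (hm : Set.MapsTo φ (Set.Icc 0 1) (Set.Icc 0 1)) (k : ℕ) (x : M) (v : Fin (2 * k) → E) {t : ℝ}
    (ht : t ∈ Set.Icc (0 : ℝ) 1) :
    (γ.reparam φ hφ hm).integrand k x v t = deriv φ t • γ.integrand k x v (φ t) := by
  have hd : HasDerivAt φ (deriv φ t) t := (hφ.differentiable (by simp) t).hasDerivAt
  have h := (γ.reparam φ hφ hm).mc_eq ht ((γ.hasEntryDeriv x (hm ht)).reparam hd hm)
  have h' : ∀ w, (γ.reparam φ hφ hm).mc x t w = γ.mc x (φ t) (w.1, w.2 * deriv φ t) := h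
  have h₁ : γ.mc x (φ t) (0, deriv φ t) = deriv φ t • γ.mc x (φ t) (0, 1) := by
    have := (maurerCartan (I.prod 𝓘(ℝ, ℝ)) (cylinder M) γ.toFun (x, φ t)).map_smul (deriv φ t)
      ((0, 1) : E × ℝ)
    refine Eq.trans ?_ this
    change _ = γ.mc x (φ t) (deriv φ t • ((0 : E), (1 : ℝ)))
    simp
  rw [UPath.integrand, UPath.integrand, ← chernForm_cons_smul]
  simp only [h', one_mul, zero_mul, h₁]

end Paths

section Concat

variable {E : Type*} [NormedAddCommGroup E] [NormedSpace ℝ E]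
  {H : Type*} [TopologicalSpace H] {I : ModelWithCorners ℝ E H}
  {M : Type*} [TopologicalSpace M] [ChartedSpace H M] {n : ℕ}

theorem UPath.intervalIntegrable_integrand [IsManifold I ∞ M] (γ : UPath I M n) (k : ℕ) (x : M)
    (v : Fin (2 * k) → E) :
    IntervalIntegrable (γ.integrand k x v) MeasureTheory.volume 0 1 := by
  refine ContinuousOn.intervalIntegrable ?_
  rw [Set.uIcc_of_le zero_le_one]
  exact γ.continuousOn_integrand k x v

theorem UPath.integral_integrand_reparam [IsManifold I ∞ M] (γ : UPath I M n) {φ : ℝ → ℝ}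
    (hφ : ContDiff ℝ ∞ φ) (hm : Set.MapsTo φ (Set.Icc 0 1) (Set.Icc 0 1)) (k : ℕ) (x : M)
    (v : Fin (2 * k) → E) :
    ∫ t in (0 : ℝ)..1, (γ.reparam φ hφ hm).integrand k x v t =
      ∫ t in (φ 0)..(φ 1), γ.integrand k x v t := by
  have h₁ : Set.uIcc (0 : ℝ) 1 = Set.Icc 0 1 := Set.uIcc_of_le zero_le_one
  have hd := hφ.differentiable (by simp)
  have := intervalIntegral.integral_deriv_smul_comp'' (a := (0 : ℝ)) (b := 1) (f := φ)
    (f' := deriv φ) (g := γ.integrand k x v) hφ.continuous.continuousOn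
    (fun t _ => (hd t).hasDerivAt.hasDerivWithinAt)
    (hφ.continuous_deriv (by simp)).continuousOn
    ((γ.continuousOn_integrand k x v).mono (by rw [h₁]; exact hm.image_subset))
  rw [← this]
  refine intervalIntegral.integral_congr fun t ht => ?_
  rw [h₁] at ht
  exact γ.integrand_reparam hφ hm k x v ht

/-- The path run backwards. -/
def UPath.reverse (γ : UPath I M n) : UPath I M n :=
  γ.reparam (fun t => 1 - t) (contDiff_const.sub contDiff_id) fun t ht => by
    constructor <;> linarith [ht.1, ht.2]

theorem UPath.CS_reverse [IsManifold I ∞ M] (γ : UPath I M n) : γ.reverse.CS = -γ.CS := by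
  ext k x v
  change γ.reverse.CS k x v = -γ.CS k x v
  rw [UPath.CS_apply, UPath.CS_apply]
  refine (UPath.integral_integrand_reparam γ _ _ k x v).trans ?_
  rw [← intervalIntegral.integral_symm, sub_zero, sub_self]

theorem UPath.integrand_congr {γ δ : UPath I M n} {x : M} {t : ℝ} (ht : t ∈ Set.Icc (0 : ℝ) 1)
    (h : ∀ᶠ q in nhdsWithin (x, t) (cylinder M), γ.toFun q = δ.toFun q) (k : ℕ)
    (v : Fin (2 * k) → E) : γ.integrand k x v t = δ.integrand k x v t := by
  have hp : γ.toFun (x, t) = δ.toFun (x, t) := h.self_of_nhdsWithin ⟨trivial, ht⟩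
  have h' : ∀ w, γ.mc x t w = δ.mc x t w := by
    intro w
    rw [γ.mc_eq ht ((δ.hasEntryDeriv x ht).congr_of_eventuallyEq
      (h.mono fun q hq => by rw [hq]) (by rw [hp])) w, δ.mc_eq ht (δ.hasEntryDeriv x ht) w, hp]
  simp only [UPath.integrand, h']

/-- A smooth function, constant for `t ≤ a / 3` and for `t ≥ (a + 1) / 3`, going from `0` to `1`. -/
def flatStep (a t : ℝ) : ℝ := Real.smoothTransition (3 * t - a)

theorem contDiff_flatStep (a : ℝ) : ContDiff ℝ ∞ (flatStep a) :=
  Real.smoothTransition.contDiff.comp ((contDiff_const.mul contDiff_id).sub contDiff_const)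

theorem mapsTo_flatStep (a : ℝ) (s : Set ℝ) : Set.MapsTo (flatStep a) s (Set.Icc 0 1) :=
  fun _ _ => ⟨Real.smoothTransition.nonneg _, Real.smoothTransition.le_one _⟩

theorem flatStep_eq_zero {a t : ℝ} (h : 3 * t ≤ a) : flatStep a t = 0 :=
  Real.smoothTransition.zero_of_nonpos (by linarith)

theorem flatStep_eq_one {a t : ℝ} (h : a + 1 ≤ 3 * t) : flatStep a t = 1 :=
  Real.smoothTransition.one_of_one_le (by linarith)

theorem deriv_flatStep_of_lt {a t : ℝ} (h : 3 * t < a) : deriv (flatStep a) t = 0 := by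
  have : flatStep a =ᶠ[nhds t] fun _ => 0 := by
    filter_upwards [gt_mem_nhds (show t < a / 3 by linarith)] with u hu
    exact flatStep_eq_zero (by linarith)
  rw [this.deriv_eq, deriv_const]

theorem deriv_flatStep_of_gt {a t : ℝ} (h : a + 1 < 3 * t) : deriv (flatStep a) t = 0 := by
  have : flatStep a =ᶠ[nhds t] fun _ => 1 := by
    filter_upwards [lt_mem_nhds (show (a + 1) / 3 < t by linarith)] with u hu
    exact flatStep_eq_one (by linarith)
  rw [this.deriv_eq, deriv_const]

/-- The path `γ`, run through in the time interval `[0, 1/3]`. -/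
def UPath.early (γ : UPath I M n) : UPath I M n :=
  γ.reparam (flatStep 0) (contDiff_flatStep 0) (mapsTo_flatStep 0 _)

/-- The path `γ`, run through in the time interval `[2/3, 1]`. -/
def UPath.late (γ : UPath I M n) : UPath I M n :=
  γ.reparam (flatStep 2) (contDiff_flatStep 2) (mapsTo_flatStep 2 _)

theorem UPath.early_apply (γ : UPath I M n) {x : M} {t : ℝ} (h : 1 / 3 < t) :
    γ.early.toFun (x, t) = γ.toFun (x, 1) := by
  change γ.toFun (x, flatStep 0 t) = _
  rw [flatStep_eq_one (by linarith)]

theorem UPath.late_apply (γ : UPath I M n) {x : M} {t : ℝ} (h : t < 2 / 3) :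
    γ.late.toFun (x, t) = γ.toFun (x, 0) := by
  change γ.toFun (x, flatStep 2 t) = _
  rw [flatStep_eq_zero (by linarith)]

/-- The values of the concatenation of two paths. -/
def concatFun (γ δ : UPath I M n) (p : M × ℝ) : Matrix.unitaryGroup (Fin n) ℂ :=
  if p.2 < 1 / 2 then γ.early.toFun p else δ.late.toFun p

theorem concatFun_of_lt {γ δ : UPath I M n} (h : ∀ x, γ.toFun (x, 1) = δ.toFun (x, 0))
    {p : M × ℝ} (hp : p.2 < 2 / 3) : concatFun γ δ p = γ.early.toFun p := by
  unfold concatFun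
  split_ifs with h'
  · rfl
  · obtain ⟨x, t⟩ := p
    rw [UPath.late_apply _ hp, UPath.early_apply _ (by simp only at h'; linarith), h]

theorem concatFun_of_gt {γ δ : UPath I M n} (h : ∀ x, γ.toFun (x, 1) = δ.toFun (x, 0))
    {p : M × ℝ} (hp : 1 / 3 < p.2) : concatFun γ δ p = δ.late.toFun p := by
  unfold concatFun
  split_ifs with h'
  · obtain ⟨x, t⟩ := p
    rw [UPath.early_apply _ hp, UPath.late_apply _ (by simp only at h'; linarith), h]
  · rfl

theorem eventually_concatFun_of_lt {γ δ : UPath I M n}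
    (h : ∀ x, γ.toFun (x, 1) = δ.toFun (x, 0)) {p : M × ℝ} (hp : p.2 < 2 / 3) :
    ∀ᶠ q in nhdsWithin p (cylinder M), concatFun γ δ q = γ.early.toFun q :=
  Filter.Eventually.filter_mono nhdsWithin_le_nhds <|
    (continuousAt_snd.eventually (gt_mem_nhds hp)).mono fun _ hq => concatFun_of_lt h hq

theorem eventually_concatFun_of_gt {γ δ : UPath I M n}
    (h : ∀ x, γ.toFun (x, 1) = δ.toFun (x, 0)) {p : M × ℝ} (hp : 1 / 3 < p.2) :
    ∀ᶠ q in nhdsWithin p (cylinder M), concatFun γ δ q = δ.late.toFun q :=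
  Filter.Eventually.filter_mono nhdsWithin_le_nhds <|
    (continuousAt_snd.eventually (lt_mem_nhds hp)).mono fun _ hq => concatFun_of_gt h hq

/-- The concatenation of two paths. -/
def UPath.concat (γ δ : UPath I M n) (h : ∀ x, γ.toFun (x, 1) = δ.toFun (x, 0)) :
    UPath I M n where
  toFun := concatFun γ δ
  smooth i j := by
    intro p hp
    rcases lt_or_ge p.2 (2 / 3) with hlt | hge
    · have he := eventually_concatFun_of_lt h hlt
      exact (γ.early.smooth i j p hp).congr_of_eventuallyEq
        (he.mono fun q hq => congrArg (fun A => A.1 i j) hq)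
        (congrArg (fun A => A.1 i j) (he.self_of_nhdsWithin hp))
    · have he := eventually_concatFun_of_gt h (p := p) (by linarith)
      exact (δ.late.smooth i j p hp).congr_of_eventuallyEq
        (he.mono fun q hq => congrArg (fun A => A.1 i j) hq)
        (congrArg (fun A => A.1 i j) (he.self_of_nhdsWithin hp))

theorem UPath.concat_zero (γ δ : UPath I M n) (h : ∀ x, γ.toFun (x, 1) = δ.toFun (x, 0)) (x : M) :
    (γ.concat δ h).toFun (x, 0) = γ.toFun (x, 0) := by
  change concatFun γ δ (x, 0) = _
  rw [concatFun_of_lt h (by norm_num)]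
  change γ.toFun (x, flatStep 0 0) = _
  rw [flatStep_eq_zero (by norm_num)]

theorem UPath.concat_one (γ δ : UPath I M n) (h : ∀ x, γ.toFun (x, 1) = δ.toFun (x, 0)) (x : M) :
    (γ.concat δ h).toFun (x, 1) = δ.toFun (x, 1) := by
  change concatFun γ δ (x, 1) = _
  rw [concatFun_of_gt h (by norm_num)]
  change δ.toFun (x, flatStep 2 1) = _
  rw [flatStep_eq_one (by norm_num)]

theorem UPath.integrand_concat (γ δ : UPath I M n) (h : ∀ x, γ.toFun (x, 1) = δ.toFun (x, 0))
    (k : ℕ) (x : M) (v : Fin (2 * k) → E) {t : ℝ} (ht : t ∈ Set.Icc (0 : ℝ) 1) :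
    (γ.concat δ h).integrand k x v t = γ.early.integrand k x v t + δ.late.integrand k x v t := by
  rcases lt_or_ge t (2 / 3) with hlt | hge
  · rw [UPath.integrand_congr ht (eventually_concatFun_of_lt h hlt) k v, left_eq_add, UPath.late,
      UPath.integrand_reparam _ _ _ _ _ _ ht, deriv_flatStep_of_lt (by linarith), zero_smul]
  · rw [UPath.integrand_congr ht (eventually_concatFun_of_gt h (p := (x, t)) (by dsimp; linarith))
      k v, right_eq_add, UPath.early, UPath.integrand_reparam _ _ _ _ _ _ ht,
      deriv_flatStep_of_gt (by linarith), zero_smul]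

theorem UPath.integral_integrand_early [IsManifold I ∞ M] (γ : UPath I M n) (k : ℕ) (x : M)
    (v : Fin (2 * k) → E) :
    ∫ t in (0 : ℝ)..1, γ.early.integrand k x v t = ∫ t in (0 : ℝ)..1, γ.integrand k x v t := by
  rw [UPath.early, UPath.integral_integrand_reparam, flatStep_eq_zero (by norm_num),
    flatStep_eq_one (by norm_num)]

theorem UPath.integral_integrand_late [IsManifold I ∞ M] (γ : UPath I M n) (k : ℕ) (x : M)
    (v : Fin (2 * k) → E) :
    ∫ t in (0 : ℝ)..1, γ.late.integrand k x v t = ∫ t in (0 : ℝ)..1, γ.integrand k x v t := by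
  rw [UPath.late, UPath.integral_integrand_reparam, flatStep_eq_zero (by norm_num),
    flatStep_eq_one (by norm_num)]

theorem UPath.CS_concat [IsManifold I ∞ M] (γ δ : UPath I M n)
    (h : ∀ x, γ.toFun (x, 1) = δ.toFun (x, 0)) : (γ.concat δ h).CS = γ.CS + δ.CS := by
  have key : ∀ (k : ℕ) (x : M) (v : Fin (2 * k) → E),
      ∫ t in (0 : ℝ)..1, (γ.concat δ h).integrand k x v t =
        (∫ t in (0 : ℝ)..1, γ.integrand k x v t) + ∫ t in (0 : ℝ)..1, δ.integrand k x v t := by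
    intro k x v
    rw [← γ.integral_integrand_early, ← δ.integral_integrand_late,
      ← intervalIntegral.integral_add (γ.early.intervalIntegrable_integrand k x v)
        (δ.late.intervalIntegrable_integrand k x v)]
    refine intervalIntegral.integral_congr fun t ht => ?_
    rw [Set.uIcc_of_le zero_le_one] at ht
    exact UPath.integrand_concat γ δ h k x v ht
  ext k x v
  change _ = γ.CS k x v + δ.CS k x v
  rw [UPath.CS_apply, UPath.CS_apply, UPath.CS_apply]
  exact key k x v

end Concat

/-! ### Exact families -/

section Exact

variable {E : Type*} [NormedAddCommGroup E] [NormedSpace ℝ E]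
  {H : Type*} [TopologicalSpace H] {I : ModelWithCorners ℝ E H}
  {M : Type*} [TopologicalSpace M] [ChartedSpace H M]

theorem Form.inChart_add {k : ℕ} (α β : Form I M k) (x : M) :
    (α + β).inChart x = α.inChart x + β.inChart x := rfl

theorem Form.inChart_smul {k : ℕ} (c : ℝ) (α : Form I M k) (x : M) :
    (c • α).inChart x = c • α.inChart x := rfl

theorem uniqueDiffWithinAt_range (x : M) :
    UniqueDiffWithinAt ℝ (Set.range I) (extChartAt I x x) :=
  I.uniqueDiffOn _ (Set.mem_range_self _)

theorem Form.IsSmooth.differentiableWithinAt {k : ℕ} {α : Form I M k} (h : α.IsSmooth) (x : M) :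
    DifferentiableWithinAt ℝ (α.inChart x) (Set.range I) (extChartAt I x x) :=
  ((h x).differentiableOn (by simp) _ (mem_extChartAt_target x)).mono_of_mem_nhdsWithin
    (extChartAt_target_mem_nhdsWithin x)

theorem Form.d_add {k : ℕ} {α β : Form I M k} (hα : α.IsSmooth) (hβ : β.IsSmooth) :
    (α + β).d = α.d + β.d := by
  ext1 x
  change (extDerivWithin ((α + β).inChart x) _ _).compContinuousLinearMap _ = _
  rw [Form.inChart_add, extDerivWithin_add (uniqueDiffWithinAt_range x)
    (hα.differentiableWithinAt x) (hβ.differentiableWithinAt x)]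
  rfl

theorem Form.d_smul {k : ℕ} (c : ℝ) (α : Form I M k) : (c • α).d = c • α.d := by
  ext1 x
  change (extDerivWithin ((c • α).inChart x) _ _).compContinuousLinearMap _ = _
  rw [Form.inChart_smul, extDerivWithin_smul _ _ (uniqueDiffWithinAt_range x)]
  rfl

theorem Form.IsSmooth.add {k : ℕ} {α β : Form I M k} (hα : α.IsSmooth) (hβ : β.IsSmooth) :
    (α + β).IsSmooth := fun x => (hα x).add (hβ x)

theorem Form.IsSmooth.smul {k : ℕ} (c : ℝ) {α : Form I M k} (hα : α.IsSmooth) :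
    (c • α).IsSmooth := fun x => (hα x).const_smul c

theorem Form.isSmooth_zero {k : ℕ} : (0 : Form I M k).IsSmooth :=
  fun _ => contDiffOn_const (c := (0 : E [⋀^Fin k]→L[ℝ] ℝ))

theorem EvenFamily.IsExact.add {c c' : EvenFamily I M} (h : c.IsExact) (h' : c'.IsExact) :
    (c + c').IsExact := by
  refine ⟨by rw [Pi.add_apply, h.1, h'.1, add_zero], fun n => ?_⟩
  obtain ⟨η, hη, e⟩ := h.2 n
  obtain ⟨η', hη', e'⟩ := h'.2 n
  refine ⟨η + η', hη.add hη', fun x v => ?_⟩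
  rw [Form.d_add hη hη']
  change c (n + 1) x v + c' (n + 1) x v = _
  rw [e, e', ← Complex.ofReal_add]
  rfl

theorem EvenFamily.IsExact.neg {c : EvenFamily I M} (h : c.IsExact) : (-c).IsExact := by
  refine ⟨by rw [Pi.neg_apply, h.1, neg_zero], fun n => ?_⟩
  obtain ⟨η, hη, e⟩ := h.2 n
  refine ⟨(-1 : ℝ) • η, hη.smul _, fun x v => ?_⟩
  rw [Form.d_smul]
  change -c (n + 1) x v = (((-1 : ℝ) * η.d x v : ℝ) : ℂ)
  rw [e]
  push_cast
  ring

theorem EvenFamily.isExact_zero : (0 : EvenFamily I M).IsExact := by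
  refine ⟨rfl, fun n => ⟨(0 : ℝ) • 0, Form.isSmooth_zero.smul _, fun x v => ?_⟩⟩
  rw [Form.d_smul]
  change (0 : ℂ) = (((0 : ℝ) * _ : ℝ) : ℂ)
  simp

end Exact

section Rotation

open Matrix

variable {k : ℕ}

/-- The rotation `cos (π t / 2) + sin (π t / 2) r`. -/
def rotMat (r : Matrix (Fin k) (Fin k) ℂ) (t : ℝ) : Matrix (Fin k) (Fin k) ℂ :=
  (Real.cos (Real.pi / 2 * t) : ℂ) • 1 + (Real.sin (Real.pi / 2 * t) : ℂ) • r

theorem rotMat_zero (r : Matrix (Fin k) (Fin k) ℂ) : rotMat r 0 = 1 := by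
  simp [rotMat]

theorem rotMat_one (r : Matrix (Fin k) (Fin k) ℂ) : rotMat r 1 = r := by
  rw [rotMat, mul_one, Real.cos_pi_div_two, Real.sin_pi_div_two]
  simp

theorem star_rotMat {r : Matrix (Fin k) (Fin k) ℂ} (hs : star r = -r) (t : ℝ) :
    star (rotMat r t) = rotMat (-r) t := by
  simp only [rotMat, star_add, star_smul, star_one, hs, Complex.star_def, Complex.conj_ofReal]

theorem rotMat_mul_rotMat_neg {r : Matrix (Fin k) (Fin k) ℂ} (hr : r * r = -1) (t : ℝ) :
    rotMat r t * rotMat (-r) t = 1 := by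
  have h : (Real.cos (Real.pi / 2 * t) : ℂ) * Real.cos (Real.pi / 2 * t) +
      (Real.sin (Real.pi / 2 * t) : ℂ) * Real.sin (Real.pi / 2 * t) = 1 := by
    norm_cast
    rw [← sq, ← sq, Real.cos_sq_add_sin_sq]
  simp only [rotMat, add_mul, mul_add, smul_mul_assoc, mul_smul_comm, one_mul, mul_one, mul_neg, hr,
    smul_neg]
  refine Eq.trans ?_ ((congrArg (· • (1 : Matrix (Fin k) (Fin k) ℂ)) h).trans (one_smul ℂ _))
  module

theorem rotMat_mul_star {r : Matrix (Fin k) (Fin k) ℂ} (hr : r * r = -1) (hs : star r = -r)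
    (t : ℝ) : rotMat r t * star (rotMat r t) = 1 := by
  rw [star_rotMat hs, rotMat_mul_rotMat_neg hr]

theorem star_rotMat_mul {r : Matrix (Fin k) (Fin k) ℂ} (hr : r * r = -1) (hs : star r = -r)
    (t : ℝ) : star (rotMat r t) * rotMat r t = 1 :=
  mul_eq_one_comm.1 (rotMat_mul_star hr hs t)

theorem hasDerivAt_rotMat {r : Matrix (Fin k) (Fin k) ℂ} (hr : r * r = -1) (t : ℝ) (i j : Fin k) :
    HasDerivAt (fun u => rotMat r u i j) (((Real.pi / 2 : ℝ) • (rotMat r t * r)) i j) t := by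
  have h₀ : HasDerivAt (fun u : ℝ => Real.pi / 2 * u) (Real.pi / 2) t := by
    simpa using (hasDerivAt_id t).const_mul (Real.pi / 2)
  have h₁ := h₀.cos.ofReal_comp.mul_const ((1 : Matrix (Fin k) (Fin k) ℂ) i j)
  have h₂ := h₀.sin.ofReal_comp.mul_const (r i j)
  refine (h₁.add h₂).congr_deriv ?_
  simp only [rotMat, add_mul, smul_mul_assoc, one_mul, hr, Matrix.smul_apply, Matrix.add_apply,
    Matrix.neg_apply, smul_eq_mul, Complex.real_smul]
  push_cast
  ring

/-- The rotation `cos (π t / 2) + sin (π t / 2) r`, for a skew-Hermitian square root `r` of `-1`. -/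
def rotU {r : Matrix (Fin k) (Fin k) ℂ} (hr : r * r = -1) (hs : star r = -r) (t : ℝ) :
    Matrix.unitaryGroup (Fin k) ℂ :=
  ⟨rotMat r t, Matrix.mem_unitaryGroup_iff.2 (rotMat_mul_star hr hs t)⟩

theorem rotation_identity (F F₁ R R₁ D D₁ F' D' r : Matrix (Fin k) (Fin k) ℂ) (c : ℝ)
    (hF : F₁ * F = 1) (hR : R₁ * R = 1) (hD : D₁ * D = 1) :
    R * D₁ * R₁ * F₁ * (((F' * R + F * (c • (R * r))) * D + F * R * D') * R₁ +
        F * R * D * (c • (-r * R₁))) =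
      R * D₁ * (R₁ * (F₁ * F') * R + D' * D₁ + c • (r - D * r * D₁)) * (D * R₁) := by
  have hF' : ∀ X, F₁ * (F * X) = X := fun X => by rw [← mul_assoc, hF, one_mul]
  have hR' : ∀ X, R₁ * (R * X) = X := fun X => by rw [← mul_assoc, hR, one_mul]
  have hD' : ∀ X, D₁ * (D * X) = X := fun X => by rw [← mul_assoc, hD, one_mul]
  simp only [mul_add, add_mul, mul_assoc, mul_sub, sub_mul, smul_mul_assoc, mul_smul_comm, hF', hR',
    hD', neg_mul, mul_neg, smul_sub, smul_neg]
  abel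

variable {E : Type*} [NormedAddCommGroup E] [NormedSpace ℝ E]
  {H : Type*} [TopologicalSpace H] {I : ModelWithCorners ℝ E H}
  {M : Type*} [TopologicalSpace M] [ChartedSpace H M]

theorem contMDiffOn_mul_entry {F : Type*} [NormedAddCommGroup F] [NormedSpace ℝ F]
    {K : Type*} [TopologicalSpace K] {J : ModelWithCorners ℝ F K}
    {N : Type*} [TopologicalSpace N] [ChartedSpace K N] {s : Set N}
    {A B : N → Matrix (Fin k) (Fin k) ℂ}
    (hA : ∀ i j, ContMDiffOn J 𝓘(ℝ, ℂ) ∞ (fun q => A q i j) s)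
    (hB : ∀ i j, ContMDiffOn J 𝓘(ℝ, ℂ) ∞ (fun q => B q i j) s) (i j : Fin k) :
    ContMDiffOn J 𝓘(ℝ, ℂ) ∞ (fun q => (A q * B q) i j) s := by
  simp only [Matrix.mul_apply]
  exact contMDiffOn_finsetSum fun l _ =>
    (contDiff_mul (𝕜 := ℝ) (𝔸 := ℂ)).contMDiff.comp_contMDiffOn ((hA i l).prodMk_space (hB l j))

theorem contMDiffOn_rotMat (r : Matrix (Fin k) (Fin k) ℂ) (i j : Fin k) :
    ContMDiffOn (I.prod 𝓘(ℝ, ℝ)) 𝓘(ℝ, ℂ) ∞ (fun q : M × ℝ => rotMat r q.2 i j) (cylinder M) := by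
  have h : ContDiff ℝ ∞ fun t : ℝ => rotMat r t i j := by
    have h₁ : ContDiff ℝ ∞ fun t : ℝ => (Real.cos (Real.pi / 2 * t) : ℂ) :=
      Complex.ofRealCLM.contDiff.comp (Real.contDiff_cos.comp (contDiff_const.mul contDiff_id))
    have h₂ : ContDiff ℝ ∞ fun t : ℝ => (Real.sin (Real.pi / 2 * t) : ℂ) :=
      Complex.ofRealCLM.contDiff.comp (Real.contDiff_sin.comp (contDiff_const.mul contDiff_id))
    exact (h₁.mul contDiff_const).add (h₂.mul contDiff_const)
  exact (h.contMDiff.comp contMDiff_snd).contMDiffOn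

/-- The path `F · R_t · D · R_t⁻¹` for the rotation `R_t` generated by `r`. -/
def UPath.rotation (F D : UMap I M k) {r : Matrix (Fin k) (Fin k) ℂ} (hr : r * r = -1)
    (hs : star r = -r) : UPath I M k where
  toFun p := F.toFun p.1 * rotU hr hs p.2 * D.toFun p.1 * (rotU hr hs p.2)⁻¹
  smooth := by
    refine contMDiffOn_mul_entry (contMDiffOn_mul_entry (contMDiffOn_mul_entry
      (UPath.const F).smooth (contMDiffOn_rotMat r)) (UPath.const D).smooth) fun i j => ?_
    refine (contMDiffOn_rotMat (-r) i j).congr fun p _ => ?_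
    rw [← star_rotMat hs]
    rfl

theorem UPath.rotation_coe (F D : UMap I M k) {r : Matrix (Fin k) (Fin k) ℂ} (hr : r * r = -1)
    (hs : star r = -r) (x : M) (t : ℝ) : ((UPath.rotation F D hr hs).toFun (x, t)).1 =
      (F.toFun x).1 * rotMat r t * (D.toFun x).1 * star (rotMat r t) := rfl

theorem UPath.mc_rotation (F D : UMap I M k) {r : Matrix (Fin k) (Fin k) ℂ} (hr : r * r = -1)
    (hs : star r = -r) (x : M) {t : ℝ} (ht : t ∈ Set.Icc (0 : ℝ) 1) (w : E × ℝ) :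
    (UPath.rotation F D hr hs).mc x t w =
      rotMat r t * star (D.toFun x).1 * (star (rotMat r t) * (star (F.toFun x).1 *
          entryMat I Set.univ F.toFun x w.1) * rotMat r t +
        entryMat I Set.univ D.toFun x w.1 * star (D.toFun x).1 +
        (w.2 * (Real.pi / 2)) • (r - (D.toFun x).1 * r * star (D.toFun x).1)) *
        ((D.toFun x).1 * star (rotMat r t)) := by
  have hR := hasEntryDeriv_snd (I := I) (x := x) (hasDerivAt_rotMat hr t)
  have hF := (F.hasEntryDeriv x).comp_fst (t := t)
  have hD := (D.hasEntryDeriv x).comp_fst (t := t)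
  have h := (UPath.rotation F D hr hs).mc_eq ht
    (((hF.mul hR).mul hD).mul hR.conjTranspose) w
  refine h.trans (Eq.trans ?_ (rotation_identity (F.toFun x).1 (star (F.toFun x).1) (rotMat r t)
    (star (rotMat r t)) (D.toFun x).1 (star (D.toFun x).1) (entryMat I Set.univ F.toFun x w.1)
    (entryMat I Set.univ D.toFun x w.1) r (w.2 * (Real.pi / 2)) (unitary_star_mul (F.toFun x))
    (star_rotMat_mul hr hs t) (unitary_star_mul (D.toFun x))))
  rw [UPath.rotation_coe]
  congr 1
  · simp only [star_mul, star_star, mul_assoc]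
  · rw [← Matrix.star_eq_conjTranspose, star_smul, star_smul, star_mul, hs, star_trivial,
      star_trivial, smul_smul, smul_smul]
    rfl

theorem UPath.integrand_rotation (F D : UMap I M k) {r : Matrix (Fin k) (Fin k) ℂ}
    (hr : r * r = -1) (hs : star r = -r) (n : ℕ) (x : M) (v : Fin (2 * n) → E) {t : ℝ}
    (ht : t ∈ Set.Icc (0 : ℝ) 1) :
    (UPath.rotation F D hr hs).integrand n x v t =
      chernForm (Fin k) n (Fin.cons
        ((Real.pi / 2 : ℝ) • (r - (D.toFun x).1 * r * star (D.toFun x).1))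
        fun i => star (rotMat r t) * (star (F.toFun x).1 *
            entryMat I Set.univ F.toFun x (v i)) * rotMat r t +
          entryMat I Set.univ D.toFun x (v i) * star (D.toFun x).1) := by
  have h₁ : (D.toFun x).1 * star (rotMat r t) * (rotMat r t * star (D.toFun x).1) = 1 := by
    rw [mul_assoc, ← mul_assoc (star (rotMat r t)), star_rotMat_mul hr hs t, one_mul,
      unitary_mul_star]
  have h₂ : rotMat r t * star (D.toFun x).1 * ((D.toFun x).1 * star (rotMat r t)) = 1 := by
    rw [mul_assoc, ← mul_assoc (star (D.toFun x).1), unitary_star_mul, one_mul]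
    exact rotMat_mul_star hr hs t
  have hF : entryMat I Set.univ F.toFun x (0 : E) = 0 := entryMat_zero F x
  have hD : entryMat I Set.univ D.toFun x (0 : E) = 0 := entryMat_zero D x
  rw [← chernForm_conj n h₁ h₂, UPath.integrand]
  congr 1
  ext i : 1
  refine Fin.cases ?_ (fun i => ?_) i
  · rw [Fin.cons_zero, Fin.cons_zero, UPath.mc_rotation _ _ _ _ _ ht]
    dsimp only
    rw [hF, hD]
    simp
  · rw [Fin.cons_succ, Fin.cons_succ, UPath.mc_rotation _ _ _ _ _ ht]
    simp

end Rotation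

section Vanishing

open Matrix

variable {m n : ℕ}

theorem blk_neg (A : Matrix (Fin m) (Fin m) ℂ) (B : Matrix (Fin m) (Fin n) ℂ)
    (C : Matrix (Fin n) (Fin m) ℂ) (D : Matrix (Fin n) (Fin n) ℂ) :
    -blk A B C D = blk (-A) (-B) (-C) (-D) := by
  rw [← neg_one_smul ℂ (blk A B C D), blk_smul]
  simp

/-- The skew-Hermitian square root of `-1` with off-diagonal blocks `-Q⁻¹` and `Q`. -/
def skew (Q : Matrix.unitaryGroup (Fin m) ℂ) : Matrix (Fin (m + m)) (Fin (m + m)) ℂ :=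
  blk 0 (-star Q.1) Q.1 0

theorem skew_mul_skew (Q : Matrix.unitaryGroup (Fin m) ℂ) : skew Q * skew Q = -1 := by
  rw [skew, blk_mul, ← blk_one, blk_neg]
  simp

theorem star_skew (Q : Matrix.unitaryGroup (Fin m) ℂ) : star (skew Q) = -skew Q := by
  rw [skew, blk_star, blk_neg]
  simp [Matrix.star_eq_conjTranspose]

theorem skew_sub_conj (Q A B : Matrix.unitaryGroup (Fin m) ℂ) :
    ∃ X Y, skew Q - (blockSum A B).1 * skew Q * star (blockSum A B).1 = blk 0 X Y 0 := by
  rw [skew, blockSum_coe, blk_star, blk_mul, blk_mul, blk_sub]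
  simp only [conjTranspose_zero, Matrix.mul_zero, Matrix.zero_mul, add_zero, zero_add, sub_zero]
  exact ⟨_, _, rfl⟩

theorem trace_blk_mul_eq_zero (X : Matrix (Fin m) (Fin n) ℂ) (Y : Matrix (Fin n) (Fin m) ℂ)
    (P : Matrix (Fin m) (Fin m) ℂ) (P' : Matrix (Fin n) (Fin n) ℂ) :
    (blk 0 X Y 0 * blk P 0 0 P').trace = 0 := by
  rw [blk_mul, blk_trace]
  simp

theorem prod_blk_diagonal (l : List (Matrix (Fin (m + n)) (Fin (m + n)) ℂ))
    (h : ∀ B ∈ l, ∃ P P', B = blk P 0 0 P') : ∃ P P', l.prod = blk P 0 0 P' := by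
  induction l with
  | nil => exact ⟨1, 1, by rw [blk_one, List.prod_nil]⟩
  | cons B l ih =>
    obtain ⟨P, P', hl⟩ := ih fun C hC => h C (List.mem_cons_of_mem _ hC)
    obtain ⟨A, A', hB⟩ := h B List.mem_cons_self
    refine ⟨A * P, A' * P', ?_⟩
    rw [List.prod_cons, hl, hB, blk_mul]
    simp

theorem prod_blk_reflection (p q : ℂ) (k : ℕ) (l : List (Matrix (Fin (m + m)) (Fin (m + m)) ℂ))
    (hl : l.length = 2 * k)
    (h : ∀ B ∈ l, ∃ a, B = blk (p • a) (-(q • a)) (-(q • a)) (-(p • a))) :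
    ∃ P P', l.prod = blk P 0 0 P' := by
  induction k generalizing l with
  | zero =>
    rw [List.length_eq_zero_iff.1 hl]
    exact ⟨1, 1, by rw [blk_one, List.prod_nil]⟩
  | succ k ih =>
    match l, hl with
    | B :: C :: l, hl =>
      obtain ⟨P, P', hP⟩ := ih l (by simp only [List.length_cons] at hl; omega)
        fun D hD => h D (List.mem_cons_of_mem _ (List.mem_cons_of_mem _ hD))
      obtain ⟨a, hB⟩ := h B List.mem_cons_self
      obtain ⟨b, hC⟩ := h C (List.mem_cons_of_mem _ List.mem_cons_self)
      have h₁ : p • a * -(q • b) + -(q • a) * -(p • b) = 0 := by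
        simp only [smul_mul_assoc, mul_smul_comm, mul_neg, neg_mul]
        module
      have h₂ : -(q • a) * p • b + -(p • a) * -(q • b) = 0 := by
        simp only [smul_mul_assoc, mul_smul_comm, mul_neg, neg_mul]
        module
      rw [List.prod_cons, List.prod_cons, hP, ← mul_assoc, hB, hC, blk_mul, h₁, h₂, blk_mul]
      exact ⟨_, _, by simp only [Matrix.mul_zero, Matrix.zero_mul, add_zero, zero_add]; rfl⟩

variable {E : Type*} [NormedAddCommGroup E] [NormedSpace ℝ E]
  {H : Type*} [TopologicalSpace H] {I : ModelWithCorners ℝ E H}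
  {M : Type*} [TopologicalSpace M] [ChartedSpace H M]

theorem entryMat_blockSum (g : UMap I M m) (h : UMap I M n) (x : M) (w : TangentSpace I x) :
    entryMat I Set.univ (g.blockSum h).toFun x w =
      blk (entryMat I Set.univ g.toFun x w) 0 0 (entryMat I Set.univ h.toFun x w) :=
  HasEntryDeriv.entryMat_eq (g := (g.blockSum h).toFun)
    ((g.hasEntryDeriv x).blk (hasEntryDeriv_const 0) (hasEntryDeriv_const 0) (h.hasEntryDeriv x))
    (uniqueMDiffWithinAt_univ I) w

theorem entryMat_one (x : M) (w : TangentSpace I x) :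
    entryMat I Set.univ (UMap.one I M n).toFun x w = 0 :=
  HasEntryDeriv.entryMat_eq (g := (UMap.one I M n).toFun) (hasEntryDeriv_const 1)
    (uniqueMDiffWithinAt_univ I) w

theorem entryMat_inv_mul (g : UMap I M n) (x : M) (w : TangentSpace I x) :
    entryMat I Set.univ g.inv.toFun x w * (g.toFun x).1 =
      -(star (g.toFun x).1 * entryMat I Set.univ g.toFun x w) := by
  have h := (g.inv.hasEntryDeriv x).mul (g.hasEntryDeriv x)
  have h' : (fun q => (g.inv.toFun q).1 * (g.toFun q).1) = fun _ => 1 :=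
    funext fun q => unitary_star_mul (g.toFun q)
  rw [h'] at h
  exact eq_neg_of_add_eq_zero_left
    (h.eq (hasEntryDeriv_const 1) (uniqueMDiffWithinAt_univ I) w)

/-- The rotation path from `A ⊕ B` to `Q⁻¹ B Q ⊕ Q A Q⁻¹`. -/
def UPath.swap (A B : UMap I M m) (Q : Matrix.unitaryGroup (Fin m) ℂ) : UPath I M (m + m) :=
  UPath.rotation (UMap.one I M (m + m)) (A.blockSum B) (skew_mul_skew Q) (star_skew Q)

theorem UPath.CS_swap (A B : UMap I M m) (Q : Matrix.unitaryGroup (Fin m) ℂ) :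
    (UPath.swap A B Q).CS = 0 := by
  refine UPath.CS_eq_zero _ fun k x v t ht => ?_
  rw [UPath.swap, UPath.integrand_rotation _ _ _ _ _ _ _ ht, chernForm_cons_smul]
  obtain ⟨X, Y, hXY⟩ := skew_sub_conj Q (A.toFun x) (B.toFun x)
  rw [chernForm_cons_eq_zero, smul_zero]
  intro l _ hl
  obtain ⟨P, P', hP⟩ := prod_blk_diagonal l fun C hC => by
    obtain ⟨i, rfl⟩ := hl C hC
    have h₁ := entryMat_one (I := I) (n := m + m) x (v i)
    have h₂ := entryMat_blockSum A B x (v i)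
    refine ⟨entryMat I Set.univ A.toFun x (v i) * star (A.toFun x).1,
      entryMat I Set.univ B.toFun x (v i) * star (B.toFun x).1, ?_⟩
    rw [h₁, h₂]
    change _ + _ * star (blk (A.toFun x).1 0 0 (B.toFun x).1) = _
    rw [blk_star, blk_mul]
    simp [Matrix.star_eq_conjTranspose]
  rw [hP]
  exact (congrArg (fun Z : Matrix (Fin (m + m)) (Fin (m + m)) ℂ =>
    (Z * blk P 0 0 P').trace) hXY).trans (trace_blk_mul_eq_zero X Y P P')

theorem UPath.swap_zero (A B : UMap I M m) (Q : Matrix.unitaryGroup (Fin m) ℂ) (x : M) :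
    ((UPath.swap A B Q).toFun (x, 0)).1 = blk (A.toFun x).1 0 0 (B.toFun x).1 := by
  rw [UPath.swap, UPath.rotation_coe, rotMat_zero, star_one, mul_one, mul_one]
  exact one_mul _

theorem UPath.swap_one (A B : UMap I M m) (Q : Matrix.unitaryGroup (Fin m) ℂ) (x : M) :
    ((UPath.swap A B Q).toFun (x, 1)).1 =
      blk (star Q.1 * (B.toFun x).1 * Q.1) 0 0 (Q.1 * (A.toFun x).1 * star Q.1) := by
  rw [UPath.swap, UPath.rotation_coe, rotMat_one]
  change 1 * skew Q * blk (A.toFun x).1 0 0 (B.toFun x).1 * star (skew Q) = _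
  rw [one_mul, skew, blk_star, blk_mul, blk_mul]
  simp [Matrix.star_eq_conjTranspose]

theorem rotMat_skew_one (t : ℝ) : rotMat (skew (1 : Matrix.unitaryGroup (Fin m) ℂ)) t =
    blk ((Real.cos (Real.pi / 2 * t) : ℂ) • 1) (-((Real.sin (Real.pi / 2 * t) : ℂ) • 1))
      ((Real.sin (Real.pi / 2 * t) : ℂ) • 1) ((Real.cos (Real.pi / 2 * t) : ℂ) • 1) := by
  rw [rotMat, skew, ← blk_one, blk_smul, blk_smul, blk_add]
  simp

/-- The rotation path from `g ⊕ g⁻¹` to `1`. -/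
def UPath.cancel (g : UMap I M m) : UPath I M (m + m) :=
  UPath.rotation (g.blockSum (UMap.one I M m)) ((UMap.one I M m).blockSum g.inv)
    (skew_mul_skew 1) (star_skew 1)

theorem conj_rotation_block (c s : ℝ) (h : (c : ℂ) * c + s * s = 1)
    (a : Matrix (Fin m) (Fin m) ℂ) :
    star (blk ((c : ℂ) • 1) (-((s : ℂ) • 1)) ((s : ℂ) • 1) ((c : ℂ) • 1)) * blk a 0 0 0 *
        blk ((c : ℂ) • 1) (-((s : ℂ) • 1)) ((s : ℂ) • 1) ((c : ℂ) • 1) + blk 0 0 0 (-a) =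
      blk (((c : ℂ) * c) • a) (-(((c : ℂ) * s) • a)) (-(((c : ℂ) * s) • a))
        (-(((c : ℂ) * c) • a)) := by
  rw [blk_star, blk_mul, blk_mul, blk_add]
  simp only [conjTranspose_smul, conjTranspose_neg, conjTranspose_one, Complex.star_def,
    Complex.conj_ofReal, smul_mul_assoc, mul_smul_comm, one_mul, mul_one, smul_zero, neg_zero,
    add_zero, neg_mul, mul_neg, smul_neg]
  congr 1
  · module
  · module
  · module
  · linear_combination (norm := module) h • a

theorem UPath.CS_cancel (g : UMap I M m) : (UPath.cancel g).CS = 0 := by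
  refine UPath.CS_eq_zero _ fun k x v t ht => ?_
  rw [UPath.cancel, UPath.integrand_rotation _ _ _ _ _ _ _ ht, chernForm_cons_smul]
  obtain ⟨X, Y, hXY⟩ := skew_sub_conj 1 ((UMap.one I M m).toFun x) (g.inv.toFun x)
  have hcs : (Real.cos (Real.pi / 2 * t) : ℂ) * Real.cos (Real.pi / 2 * t) +
      (Real.sin (Real.pi / 2 * t) : ℂ) * Real.sin (Real.pi / 2 * t) = 1 := by
    norm_cast
    rw [← sq, ← sq, Real.cos_sq_add_sin_sq]
  rw [chernForm_cons_eq_zero, smul_zero]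
  intro l hlen hl
  obtain ⟨P, P', hP⟩ := prod_blk_reflection
    ((Real.cos (Real.pi / 2 * t) : ℂ) * Real.cos (Real.pi / 2 * t))
    ((Real.cos (Real.pi / 2 * t) : ℂ) * Real.sin (Real.pi / 2 * t)) k l hlen fun C hC => by
    obtain ⟨i, rfl⟩ := hl C hC
    refine ⟨star (g.toFun x).1 * entryMat I Set.univ g.toFun x (v i), ?_⟩
    have h₁ := entryMat_one (I := I) (n := m) x (v i)
    have h₂ := entryMat_blockSum g (UMap.one I M m) x (v i)
    have h₃ := entryMat_blockSum (UMap.one I M m) g.inv x (v i)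
    have h₄ := entryMat_inv_mul g x (v i)
    rw [h₁] at h₂ h₃
    have h₅ : star ((g.blockSum (UMap.one I M m)).toFun x).1 *
        entryMat I Set.univ (g.blockSum (UMap.one I M m)).toFun x (v i) =
        blk (star (g.toFun x).1 * entryMat I Set.univ g.toFun x (v i)) 0 0 0 := by
      refine (congrArg (star ((g.blockSum (UMap.one I M m)).toFun x).1 * ·) h₂).trans ?_
      change star (blk (g.toFun x).1 0 0 1) * _ = _
      rw [blk_star, blk_mul]
      simp [Matrix.star_eq_conjTranspose]
    have h₆ : entryMat I Set.univ ((UMap.one I M m).blockSum g.inv).toFun x (v i) *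
        star (((UMap.one I M m).blockSum g.inv).toFun x).1 =
        blk 0 0 0 (-(star (g.toFun x).1 * entryMat I Set.univ g.toFun x (v i))) := by
      refine (congrArg (· * star (((UMap.one I M m).blockSum g.inv).toFun x).1) h₃).trans ?_
      change _ * star (blk 1 0 0 (star (g.toFun x).1)) = _
      rw [blk_star, blk_mul, ← Matrix.star_eq_conjTranspose (star _), star_star, h₄]
      simp
    rw [h₅, h₆, rotMat_skew_one]
    exact conj_rotation_block _ _ hcs _
  rw [hP]
  exact (congrArg (fun Z : Matrix (Fin (m + m)) (Fin (m + m)) ℂ =>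
    (Z * blk P 0 0 P').trace) hXY).trans (trace_blk_mul_eq_zero X Y P P')

theorem UPath.cancel_zero (g : UMap I M m) (x : M) :
    ((UPath.cancel g).toFun (x, 0)).1 = blk (g.toFun x).1 0 0 (g.inv.toFun x).1 := by
  rw [UPath.cancel, UPath.rotation_coe, rotMat_zero, star_one, mul_one, mul_one]
  change blk (g.toFun x).1 0 0 1 * blk 1 0 0 (g.inv.toFun x).1 = _
  rw [blk_mul]
  simp

theorem UPath.cancel_one (g : UMap I M m) (x : M) :
    ((UPath.cancel g).toFun (x, 1)).1 = 1 := by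
  rw [UPath.cancel, UPath.rotation_coe, rotMat_one]
  change blk (g.toFun x).1 0 0 1 * skew 1 * blk 1 0 0 (star (g.toFun x).1) * star (skew 1) = _
  rw [star_skew, skew, blk_neg, blk_mul, blk_mul, blk_mul, ← blk_one]
  simp

end Vanishing

section Stable

open Matrix

variable {m n : ℕ}

/-- The block sum of infinite matrices, the first of which is supported in size `m`. -/
def blockStab (m : ℕ) (a b : ℕ → ℕ → ℂ) : ℕ → ℕ → ℂ := fun i j =>
  if i < m ∧ j < m then a i j else if m ≤ i ∧ m ≤ j then b (i - m) (j - m) else 0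

theorem stabilize_blockSum (A : Matrix.unitaryGroup (Fin m) ℂ)
    (B : Matrix.unitaryGroup (Fin n) ℂ) :
    stabilize (blockSum A B) = blockStab m (stabilize A) (stabilize B) := by
  have hl : ∀ (i : ℕ) (hi : i < m) (h : i < m + n),
      finSumFinEquiv.symm (⟨i, h⟩ : Fin (m + n)) = Sum.inl ⟨i, hi⟩ := fun i hi h => by
    rw [Equiv.symm_apply_eq]
    rfl
  have hr : ∀ (i : ℕ) (hi : m ≤ i) (h : i < m + n),
      finSumFinEquiv.symm (⟨i, h⟩ : Fin (m + n)) = Sum.inr ⟨i - m, by omega⟩ := fun i hi h => by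
    rw [Equiv.symm_apply_eq]
    ext
    simp only [finSumFinEquiv_apply_right, Fin.val_natAdd]
    omega
  ext i j
  simp only [stabilize, blockStab, blockSum, Matrix.reindex_apply, Matrix.submatrix_apply]
  rcases lt_or_ge i m with hi | hi <;> rcases lt_or_ge j m with hj | hj
  · rw [dif_pos (by omega), if_pos ⟨hi, hj⟩, dif_pos ⟨hi, hj⟩, hl i hi, hl j hj,
      Matrix.fromBlocks_apply₁₁]
  · rw [if_neg (by omega : i ≠ j), if_neg (by omega : ¬(i < m ∧ j < m)),
      if_neg (by omega : ¬(m ≤ i ∧ m ≤ j))]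
    split_ifs with h
    · rw [hl i hi, hr j hj, Matrix.fromBlocks_apply₁₂, Matrix.zero_apply]
    · rfl
  · rw [if_neg (by omega : i ≠ j), if_neg (by omega : ¬(i < m ∧ j < m)),
      if_neg (by omega : ¬(m ≤ i ∧ m ≤ j))]
    split_ifs with h
    · rw [hr i hi, hl j hj, Matrix.fromBlocks_apply₂₁, Matrix.zero_apply]
    · rfl
  · rw [if_neg (by omega : ¬(i < m ∧ j < m)), if_pos (show m ≤ i ∧ m ≤ j from ⟨hi, hj⟩)]
    by_cases h : i < m + n ∧ j < m + n
    · rw [dif_pos h, dif_pos (by omega), hr i hi, hr j hj, Matrix.fromBlocks_apply₂₂]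
    · have h₂ : i = j ↔ i - m = j - m := by omega
      rw [dif_neg h, dif_neg (by omega), if_congr h₂ rfl rfl]

theorem stabilize_one : stabilize (1 : Matrix.unitaryGroup (Fin n) ℂ) =
    fun i j => if i = j then 1 else 0 := by
  ext i j
  simp only [stabilize]
  split_ifs with h h' h'
  · exact (Matrix.one_apply).trans (by simp [h'])
  · exact (Matrix.one_apply).trans (by simp [h'])
  · rfl
  · rfl

theorem stabilize_blockSum_one (A : Matrix.unitaryGroup (Fin m) ℂ) :
    stabilize (blockSum A (1 : Matrix.unitaryGroup (Fin n) ℂ)) = stabilize A := by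
  rw [stabilize_blockSum, stabilize_one]
  ext i j
  simp only [blockStab, stabilize]
  grind

theorem blockStab_assoc (a b c : ℕ → ℕ → ℂ) :
    blockStab (m + n) (blockStab m a b) c = blockStab m a (blockStab n b c) := by
  ext i j
  simp only [blockStab, Nat.sub_sub]
  grind

theorem stabilize_injective :
    Function.Injective (stabilize : Matrix.unitaryGroup (Fin n) ℂ → ℕ → ℕ → ℂ) := by
  intro A B h
  ext i j
  have := congrFun (congrFun h i) j
  simpa [stabilize] using this

theorem stabilize_congr (A : Matrix.unitaryGroup (Fin m) ℂ) (B : Matrix.unitaryGroup (Fin n) ℂ)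
    (h : m = n) (hAB : ∀ i j, A.1 i j = B.1 (Fin.cast h i) (Fin.cast h j)) :
    stabilize A = stabilize B := by
  subst h
  exact congrArg stabilize (Subtype.ext (Matrix.ext hAB))

/-- The unitary matrix of a permutation. -/
def permU (σ : Equiv.Perm (Fin n)) : Matrix.unitaryGroup (Fin n) ℂ :=
  ⟨(1 : Matrix (Fin n) (Fin n) ℂ).submatrix id σ.symm, by
    rw [Matrix.mem_unitaryGroup_iff', Matrix.star_eq_conjTranspose, Matrix.conjTranspose_submatrix,
      Matrix.conjTranspose_one, Matrix.submatrix_mul _ _ _ id _ Function.bijective_id |>.symm,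
      Matrix.one_mul, Matrix.submatrix_one_equiv]⟩

theorem permU_conj (σ : Equiv.Perm (Fin n)) (A : Matrix (Fin n) (Fin n) ℂ) :
    star (permU σ).1 * A * (permU σ).1 = A.submatrix σ.symm σ.symm := by
  ext i j
  simp [permU, Matrix.star_eq_conjTranspose, Matrix.mul_apply, Matrix.one_apply]

/-- Conjugation by a permutation matrix exchanges the summands of a block sum. -/
theorem stabilize_permU_conj (A : Matrix.unitaryGroup (Fin m) ℂ)
    (B : Matrix.unitaryGroup (Fin n) ℂ) :
    stabilize ((permU (finAddFlip.trans (finCongr (add_comm n m))))⁻¹ * blockSum A B *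
      permU (finAddFlip.trans (finCongr (add_comm n m)))) = stabilize (blockSum B A) := by
  refine stabilize_congr _ _ (add_comm m n) fun i j => ?_
  refine (congrFun (congrFun (permU_conj _ (blockSum A B).1) i) j).trans ?_
  change (blockSum A B).1 (finAddFlip.symm (Fin.cast (add_comm m n) i))
    (finAddFlip.symm (Fin.cast (add_comm m n) j)) = _
  generalize Fin.cast (add_comm m n) i = i
  generalize Fin.cast (add_comm m n) j = j
  obtain ⟨i, rfl⟩ := finSumFinEquiv.surjective i
  obtain ⟨j, rfl⟩ := finSumFinEquiv.surjective j
  rcases i with i | i <;> rcases j with j | j <;> simp [blockSum, finAddFlip]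

variable {E : Type*} [NormedAddCommGroup E] [NormedSpace ℝ E]
  {H : Type*} [TopologicalSpace H] {I : ModelWithCorners ℝ E H}
  {M : Type*} [TopologicalSpace M] [ChartedSpace H M]

theorem UMap.toStable_eq {g : UMap I M m} {h : UMap I M n}
    (e : ∀ x, stabilize (g.toFun x) = stabilize (h.toFun x)) : g.toStable = h.toStable :=
  Subtype.ext (funext e)

theorem UMap.toStable_apply {g : UMap I M m} {h : UMap I M n} (e : g.toStable = h.toStable)
    (x : M) : stabilize (g.toFun x) = stabilize (h.toFun x) :=
  congrFun (congrArg Subtype.val e) x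

theorem UPath.joins_of {γ : UPath I M m} {k l : ℕ} {g : UMap I M k} {h : UMap I M l}
    (h₀ : ∀ x, stabilize (γ.toFun (x, 0)) = stabilize (g.toFun x))
    (h₁ : ∀ x, stabilize (γ.toFun (x, 1)) = stabilize (h.toFun x)) :
    γ.Joins g.toStable h.toStable :=
  ⟨UMap.toStable_eq h₀, UMap.toStable_eq h₁⟩

theorem UPath.exists_enlarge (γ : UPath I M m) (h : m ≤ n) : ∃ δ : UPath I M n,
    δ.CS = γ.CS ∧ ∀ p, stabilize (δ.toFun p) = stabilize (γ.toFun p) := by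
  obtain ⟨k, rfl⟩ := Nat.exists_eq_add_of_le h
  exact ⟨γ.blockSum (UPath.const (UMap.one I M k)), γ.CS_blockSum_const _,
    fun p => stabilize_blockSum_one _⟩

theorem UPath.exists_trans [IsManifold I ∞ M] {γ : UPath I M m} {δ : UPath I M n}
    {f g h : StableMap I M} (hγ : γ.Joins f g) (hδ : δ.Joins g h) :
    ∃ (k : ℕ) (ε : UPath I M k), ε.Joins f h ∧ ε.CS = γ.CS + δ.CS := by
  obtain ⟨γ', hγ', eγ⟩ := γ.exists_enlarge (le_max_left m n)
  obtain ⟨δ', hδ', eδ⟩ := δ.exists_enlarge (le_max_right m n)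
  have hmatch : ∀ x, γ'.toFun (x, 1) = δ'.toFun (x, 0) := fun x =>
    stabilize_injective (by
      rw [eγ, eδ]
      exact UMap.toStable_apply (hγ.2.trans hδ.1.symm) x)
  refine ⟨_, γ'.concat δ' hmatch, ?_, by rw [UPath.CS_concat, hγ', hδ']⟩
  obtain ⟨rfl, -⟩ := hγ
  obtain ⟨-, rfl⟩ := hδ
  refine UPath.joins_of (fun x => ?_) fun x => ?_
  · rw [UPath.concat_zero, eγ]
    rfl
  · rw [UPath.concat_one, eδ]
    rfl

theorem UPath.Joins.reverse {γ : UPath I M m} {f g : StableMap I M} (h : γ.Joins f g) :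
    γ.reverse.Joins g f := by
  obtain ⟨rfl, rfl⟩ := h
  refine UPath.joins_of (fun x => ?_) fun x => ?_
  · change stabilize (γ.toFun (x, 1 - 0)) = stabilize (γ.toFun (x, 1))
    rw [sub_zero]
  · change stabilize (γ.toFun (x, 1 - 1)) = stabilize (γ.toFun (x, 0))
    rw [sub_self]

theorem equivalence_CSEquiv [IsManifold I ∞ M] : Equivalence (CSEquiv I M) where
  refl := by
    rintro ⟨_, n, g, rfl⟩
    exact ⟨n, UPath.const g, ⟨rfl, rfl⟩, by rw [UPath.CS_const]; exact EvenFamily.isExact_zero⟩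
  symm := by
    rintro f g ⟨n, γ, h, hγ⟩
    exact ⟨n, γ.reverse, h.reverse, by rw [UPath.CS_reverse]; exact hγ.neg⟩
  trans := by
    rintro f g h ⟨m, γ, h₁, hγ⟩ ⟨n, δ, h₂, hδ⟩
    obtain ⟨k, ε, h₃, hε⟩ := UPath.exists_trans h₁ h₂
    exact ⟨k, ε, h₃, by rw [hε]; exact hγ.add hδ⟩

theorem exists_path_blockSum_comm [IsManifold I ∞ M] (g : UMap I M m) (h : UMap I M n) :
    ∃ (k : ℕ) (γ : UPath I M k),
      γ.Joins (g.blockSum h).toStable (h.blockSum g).toStable ∧ γ.CS = 0 := by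
  set Q := permU ((finAddFlip (m := m) (n := n)).trans (finCongr (add_comm n m)))
  set e := UMap.one I M (m + n) with he
  have h₁ : (UPath.swap (g.blockSum h) e 1).Joins (g.blockSum h).toStable
      (e.blockSum (g.blockSum h)).toStable := by
    refine UPath.joins_of (fun x => ?_) fun x => ?_
    · refine Eq.trans (congrArg stabilize ?_)
        (stabilize_blockSum_one (n := m + n) ((g.blockSum h).toFun x))
      exact Subtype.ext (UPath.swap_zero _ _ _ _)
    · refine congrArg stabilize (Subtype.ext ((UPath.swap_one _ _ _ _).trans ?_))
      change _ = blk 1 0 0 _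
      simp [he, UMap.one]
  have h₂ : (UPath.swap e (g.blockSum h) Q).Joins (e.blockSum (g.blockSum h)).toStable
      (h.blockSum g).toStable := by
    refine UPath.joins_of (fun x => ?_) fun x => ?_
    · exact congrArg stabilize (Subtype.ext (UPath.swap_zero _ _ _ _))
    · refine Eq.trans (congrArg stabilize ?_) ((stabilize_blockSum_one (n := m + n)
        (Q⁻¹ * (g.blockSum h).toFun x * Q)).trans (stabilize_permU_conj _ _))
      refine Subtype.ext ((UPath.swap_one _ _ _ _).trans ?_)
      have : Q.1 * ((e.toFun x).1 * star Q.1) = 1 := by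
        refine (congrArg (Q.1 * ·) (one_mul (star Q.1))).trans (unitary_mul_star Q)
      rw [mul_assoc Q.1, this]
      rfl
  obtain ⟨k, γ, hγ, e'⟩ := UPath.exists_trans h₁ h₂
  exact ⟨k, γ, hγ, by rw [e', UPath.CS_swap, UPath.CS_swap, add_zero]⟩

theorem exists_path_blockSum_inv (g : UMap I M n) :
    ∃ (k : ℕ) (γ : UPath I M k),
      γ.Joins (g.blockSum g.inv).toStable (UMap.one I M n).toStable ∧ γ.CS = 0 := by
  refine ⟨n + n, UPath.cancel g, UPath.joins_of (fun x => ?_) fun x => ?_, UPath.CS_cancel g⟩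
  · exact congrArg stabilize (Subtype.ext (UPath.cancel_zero g x))
  · rw [show (UPath.cancel g).toFun (x, 1) = 1 from Subtype.ext (UPath.cancel_one g x)]
    exact stabilize_one.trans stabilize_one.symm

/-! ### The group structure -/

theorem UMap.cls_eq_of_path {g : UMap I M m} {h : UMap I M n} {k : ℕ} {γ : UPath I M k}
    (hγ : γ.Joins g.toStable h.toStable) (h₀ : γ.CS = 0) : g.cls = h.cls :=
  Quot.sound ⟨k, γ, hγ, by rw [h₀]; exact EvenFamily.isExact_zero⟩

theorem UMap.cls_congr {g : UMap I M m} {h : UMap I M n} (e : g.toStable = h.toStable) :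
    g.cls = h.cls :=
  congrArg (Quot.mk _) e

theorem UMap.cls_blockSum_comm [IsManifold I ∞ M] (g : UMap I M m) (h : UMap I M n) :
    (g.blockSum h).cls = (h.blockSum g).cls := by
  obtain ⟨k, γ, hγ, h₀⟩ := exists_path_blockSum_comm g h
  exact UMap.cls_eq_of_path hγ h₀

theorem UMap.cls_blockSum_assoc {k : ℕ} (f : UMap I M k) (g : UMap I M m) (h : UMap I M n) :
    ((f.blockSum g).blockSum h).cls = (f.blockSum (g.blockSum h)).cls :=
  UMap.cls_congr <| UMap.toStable_eq fun x => by
    change stabilize (OddDiffK.blockSum (OddDiffK.blockSum _ _) _) =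
      stabilize (OddDiffK.blockSum _ (OddDiffK.blockSum _ _))
    simp only [stabilize_blockSum, blockStab_assoc]

theorem UMap.cls_blockSum_one (g : UMap I M m) : (g.blockSum (UMap.one I M n)).cls = g.cls :=
  UMap.cls_congr <| UMap.toStable_eq fun _ => stabilize_blockSum_one _

theorem UMap.cls_one : (UMap.one I M m).cls = (UMap.one I M n).cls :=
  UMap.cls_congr <| UMap.toStable_eq fun _ => stabilize_one.trans stabilize_one.symm

theorem UMap.cls_blockSum_inv (g : UMap I M m) :
    (g.blockSum g.inv).cls = (UMap.one I M n).cls := by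
  obtain ⟨k, γ, hγ, h₀⟩ := exists_path_blockSum_inv g
  exact (UMap.cls_eq_of_path hγ h₀).trans UMap.cls_one

theorem UMap.cls_blockSum_right [IsManifold I ∞ M] {k : ℕ} (h : UMap I M k) {g : UMap I M m}
    {g' : UMap I M n} (e : g.cls = g'.cls) : (h.blockSum g).cls = (h.blockSum g').cls := by
  obtain ⟨l, γ, ⟨h₀, h₁⟩, hγ⟩ := (equivalence_CSEquiv.quot_mk_eq_iff _ _).1 e
  refine Quot.sound ⟨k + l, (UPath.const h).blockSum γ, ?_, by rwa [UPath.CS_const_blockSum]⟩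
  refine UPath.joins_of (fun x => ?_) fun x => ?_
  · change stabilize (OddDiffK.blockSum (h.toFun x) (γ.toFun (x, 0))) =
      stabilize (OddDiffK.blockSum (h.toFun x) (g.toFun x))
    rw [stabilize_blockSum, stabilize_blockSum]
    exact congrArg _ (UMap.toStable_apply h₀ x)
  · change stabilize (OddDiffK.blockSum (h.toFun x) (γ.toFun (x, 1))) =
      stabilize (OddDiffK.blockSum (h.toFun x) (g'.toFun x))
    rw [stabilize_blockSum, stabilize_blockSum]
    exact congrArg _ (UMap.toStable_apply h₁ x)

theorem UMap.cls_blockSum [IsManifold I ∞ M] {k l : ℕ} {g : UMap I M m} {g' : UMap I M n}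
    {h : UMap I M k} {h' : UMap I M l} (e : g.cls = g'.cls) (e' : h.cls = h'.cls) :
    (g.blockSum h).cls = (g'.blockSum h').cls := by
  rw [UMap.cls_blockSum_right g e', UMap.cls_blockSum_comm, UMap.cls_blockSum_right h' e,
    UMap.cls_blockSum_comm]

theorem KHat.exists_rep (a : KHat I M) : ∃ g : Σ n, UMap I M n, g.2.cls = a := by
  obtain ⟨⟨_, n, g, rfl⟩, rfl⟩ := Quot.exists_rep a
  exact ⟨⟨n, g⟩, rfl⟩

/-- A map to a unitary group that represents a class. -/
def KHat.rep (a : KHat I M) : Σ n, UMap I M n := (KHat.exists_rep a).choose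

theorem KHat.cls_rep (a : KHat I M) : (KHat.rep a).2.cls = a := (KHat.exists_rep a).choose_spec

/-- The sum of classes that is induced by the block sum. -/
def KHat.add (a b : KHat I M) : KHat I M := (a.rep.2.blockSum b.rep.2).cls

theorem KHat.add_cls [IsManifold I ∞ M] (g : UMap I M m) (h : UMap I M n) :
    KHat.add g.cls h.cls = (g.blockSum h).cls :=
  UMap.cls_blockSum (KHat.cls_rep _) (KHat.cls_rep _)

variable (I M) in
/-- The group structure on `K̂⁻¹(M)` induced by the block sum. -/
abbrev KHat.addCommGroup [IsManifold I ∞ M] : AddCommGroup (KHat I M) where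
  add := KHat.add
  zero := (UMap.one I M 0).cls
  neg a := a.rep.2.inv.cls
  nsmul := @nsmulRec _ ⟨(UMap.one I M 0).cls⟩ ⟨KHat.add⟩
  zsmul := @zsmulRec _ ⟨(UMap.one I M 0).cls⟩ ⟨KHat.add⟩ ⟨fun a => a.rep.2.inv.cls⟩
    (@nsmulRec _ ⟨(UMap.one I M 0).cls⟩ ⟨KHat.add⟩)
  add_assoc a b c := by
    change KHat.add (KHat.add a b) c = KHat.add a (KHat.add b c)
    rw [← a.cls_rep, ← b.cls_rep, ← c.cls_rep]
    simp only [KHat.add_cls, UMap.cls_blockSum_assoc]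
  zero_add a := by
    change KHat.add (UMap.one I M 0).cls a = a
    rw [← a.cls_rep, KHat.add_cls, UMap.cls_blockSum_comm, UMap.cls_blockSum_one]
  add_zero a := by
    change KHat.add a (UMap.one I M 0).cls = a
    rw [← a.cls_rep, KHat.add_cls, UMap.cls_blockSum_one]
  neg_add_cancel a := by
    change KHat.add a.rep.2.inv.cls a = (UMap.one I M 0).cls
    refine (congrArg (KHat.add _) a.cls_rep).symm.trans ?_
    rw [KHat.add_cls, UMap.cls_blockSum_comm, UMap.cls_blockSum_inv]
  add_comm a b := by
    change KHat.add a b = KHat.add b a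
    rw [← a.cls_rep, ← b.cls_rep, KHat.add_cls, KHat.add_cls, UMap.cls_blockSum_comm]

end Stable

end OddDiffK

end

theorem proposition5p1
    {E : Type*} [NormedAddCommGroup E] [NormedSpace ℝ E] [FiniteDimensional ℝ E]
    {H : Type*} [TopologicalSpace H] (I : ModelWithCorners ℝ E H)
    (M : Type*) [TopologicalSpace M] [ChartedSpace H M] [IsManifold I ∞ M]
    [CompactSpace M] [T2Space M] :
    Equivalence (OddDiffK.CSEquiv I M) ∧
    (∃! _G : AddCommGroup (OddDiffK.KHat I M),
      (∀ (m n : ℕ) (g : OddDiffK.UMap I M m) (h : OddDiffK.UMap I M n),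
        (g.blockSum h).cls = g.cls + h.cls) ∧
      (∀ n : ℕ, (OddDiffK.UMap.one I M n).cls = 0) ∧
      (∀ (n : ℕ) (g : OddDiffK.UMap I M n), g.inv.cls = -g.cls)) ∧
    (∀ (m n : ℕ) (g : OddDiffK.UMap I M m) (h : OddDiffK.UMap I M n),
      ∃ (k : ℕ) (γ : OddDiffK.UPath I M k),
        γ.Joins (g.blockSum h).toStable (h.blockSum g).toStable ∧ γ.CS = 0) ∧
    (∀ (n : ℕ) (g : OddDiffK.UMap I M n),
      ∃ (k : ℕ) (γ : OddDiffK.UPath I M k),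
        γ.Joins (g.blockSum g.inv).toStable (OddDiffK.UMap.one I M n).toStable ∧ γ.CS = 0) := by
  refine ⟨OddDiffK.equivalence_CSEquiv, ⟨OddDiffK.KHat.addCommGroup I M, ?_, ?_⟩,
    fun m n g h => OddDiffK.exists_path_blockSum_comm g h,
    fun n g => OddDiffK.exists_path_blockSum_inv g⟩
  · let _ := OddDiffK.KHat.addCommGroup I M
    have hadd : ∀ (m n : ℕ) (g : OddDiffK.UMap I M m) (h : OddDiffK.UMap I M n),
        (g.blockSum h).cls = g.cls + h.cls := fun m n g h => (OddDiffK.KHat.add_cls g h).symm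
    have hzero : ∀ n : ℕ, (OddDiffK.UMap.one I M n).cls = 0 := fun n => OddDiffK.UMap.cls_one
    refine ⟨hadd, hzero, fun n g => eq_neg_of_add_eq_zero_right ?_⟩
    rw [← hadd, OddDiffK.UMap.cls_blockSum_inv (n := 0), hzero]
  · rintro G ⟨hadd, -, -⟩
    refine AddCommGroup.ext (funext fun a => funext fun b => ?_)
    rw [← a.cls_rep, ← b.cls_rep]
    exact (hadd _ _ _ _).symm.trans (OddDiffK.KHat.add_cls _ _).symm
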